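/- **Theorem.** A differentiable $f:\mathbb R^d\to\mathbb R$ is $\ell$-smooth if $\|\nabla f(x)-\nabla f(y)\|\le \ell\|x-y\|$ for all $x,y$; a twice differentiable $f$ is $\rho$-Hessian Lipschitz if $\|\nabla^2 f(x)-\nabla^2 f(y)\|\le\rho\|x-y\|$ (spectral norm) for all $x,y$. A point $x$ is an $\epsilon$-second-order stationary point if $\|\nabla f(x)\|\le\epsilon$ and $\lambda_{\min}(\nabla^2 f(x))\ge-\sqrt{\rho\epsilon}$. The algorithm $\mathrm{PGD}(x_0,\ell,\rho,\epsilon,c,\delta,\Delta_f)$ uses the parameters $$\chi=3\max\Big\{\log\frac{d\ell\Delta_f}{c\epsilon^2\delta},\,4\Big\},\quad \eta=\frac c\ell,\quad r=\frac{\sqrt c}{\chi^2}\cdot\frac\epsilon\ell,\quad g_{\rm thres}=\frac{\sqrt c}{\chi^2}\,\epsilon,\quad f_{\rm thres}=\frac{c}{\chi^3}\sqrt{\frac{\epsilon^3}{\rho}},\quad t_{\rm thres}=\Big\lceil\frac{\chi}{c^2}\cdot\frac{\ell}{\sqrt{\rho\epsilon}}\Big\rceil$$ (with $\log 0=-\infty$).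 It starts with $t_{\rm noise}=-t_{\rm thres}-1$ and performs, for $t=0,1,2,\dots$, the following iteration: (i) if $\|\nabla f(x_t)\|\le g_{\rm thres}$ and $t-t_{\rm noise}>t_{\rm thres}$, set $\tilde x_t=x_t$, $t_{\rm noise}=t$, and replace $x_t$ by $\tilde x_t+\xi_t$; (ii) if $t-t_{\rm noise}=t_{\rm thres}$ and $f(x_t)-f(\tilde x_{t_{\rm noise}})>-f_{\rm thres}$, return $\tilde x_{t_{\rm noise}}$; (iii) otherwise set $x_{t+1}=x_t-\eta\nabla f(x_t)$. Here $\xi_0,\xi_1,\dots$ are independent and uniformly distributed on the Euclidean ball of radius $r$ around $0$ in $\mathbb R^d$. There is an absolute constant $c_{\max}>0$ such that for every $c\in(0,c_{\max}]$ there is a constant $C>0$ depending only on $c$ with the following property. Let $d\ge1$, $\ell,\rho,\epsilon,\delta>0$ with $\epsilon\le\ell^2/\rho$, let $f:\mathbb R^d\to\mathbb R$ be $\ell$-smooth, $\rho$-Hessian Lipschitz and bounded below with $f^\star=\inf f$, let $x_0\in\mathbb R^d$, and let $\Delta_f\ge f(x_0)-f^\star$. Put $$B=\frac{\ell\,(f(x_0)-f^\star)}{\epsilon^2}\,\Big(\max\Big\{1,\log\frac{d\ell\Delta_f}{\epsilon^2\delta}\Big\}\Big)^4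 .$$ Then with probability at least $1-\delta$, $\mathrm{PGD}(x_0,\ell,\rho,\epsilon,c,\delta,\Delta_f)$ returns an $\epsilon$-second-order stationary point after a number $N$ of iterations that satisfies $$N\le C\,B+t_{\rm thres}+1,$$ and, whenever $f(x_0)-f^\star\ge f_{\rm thres}$, even $N\le C\,B=O\Big(\frac{\ell(f(x_0)-f^\star)}{\epsilon^2}\log^4\frac{d\ell\Delta_f}{\epsilon^2\delta}\Big)$ (logarithm read as at least $1$). -/

import Mathlib

open MeasureTheory ProbabilityTheory

noncomputable section

namespace PGD

/-! ### Smoothness classes and second-order stationarity on `ℝ^d` -/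

/-- `ℝ^d` with the Euclidean norm. -/
abbrev Vec (d : ℕ) : Type := EuclideanSpace ℝ (Fin d)

/-- The Hessian of `f` at `x`, as a linear operator: the derivative of the gradient field.
Its norm is the spectral norm. -/
def hessian {d : ℕ} (f : Vec d → ℝ) (x : Vec d) : Vec d →L[ℝ] Vec d :=
  fderiv ℝ (gradient f) x

/-- `f` is differentiable with `ℓ`-Lipschitz gradient. -/
def IsSmooth {d : ℕ} (ℓ : ℝ) (f : Vec d → ℝ) : Prop :=
  Differentiable ℝ f ∧ ∀ x y : Vec d, ‖gradient f x - gradient f y‖ ≤ ℓ * ‖x - y‖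

/-- `f` is twice differentiable with `ρ`-Lipschitz Hessian (in spectral norm). -/
def IsHessianLipschitz {d : ℕ} (ρ : ℝ) (f : Vec d → ℝ) : Prop :=
  Differentiable ℝ f ∧ Differentiable ℝ (gradient f) ∧
    ∀ x y : Vec d, ‖hessian f x - hessian f y‖ ≤ ρ * ‖x - y‖

/-- The smallest (real) eigenvalue of an operator on `ℝ^d`. It is applied to Hessians, which are
symmetric, so for `d ≥ 1` the set below is finite and nonempty. -/
def lambdaMin {d : ℕ} (A : Vec d →L[ℝ] Vec d) : ℝ :=
  sInf {μ : ℝ | Module.End.HasEigenvalue (A : Vec d →ₗ[ℝ] Vec d) μ}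

/-- `x` is an `ε`-second-order stationary point of the `ρ`-Hessian Lipschitz function `f`. -/
def IsSecondOrderStationary {d : ℕ} (ρ ε : ℝ) (f : Vec d → ℝ) (x : Vec d) : Prop :=
  ‖gradient f x‖ ≤ ε ∧ -√(ρ * ε) ≤ lambdaMin (hessian f x)

/-! ### Parameters of perturbed gradient descent -/

/-- `χ = 3 max {log (d ℓ Δ_f / (c ε² δ)), 4}`. -/
def chi (d : ℕ) (ℓ ε c δ Δf : ℝ) : ℝ :=
  3 * max (Real.log (d * ℓ * Δf / (c * ε ^ 2 * δ))) 4

/-- The step size `η = c / ℓ`. -/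
def stepSize (ℓ c : ℝ) : ℝ := c / ℓ

/-- The perturbation radius `r = (√c / χ²) · (ε / ℓ)`. -/
def radius (d : ℕ) (ℓ ε c δ Δf : ℝ) : ℝ :=
  √c / chi d ℓ ε c δ Δf ^ 2 * (ε / ℓ)

/-- The gradient threshold `g_thres = (√c / χ²) · ε`. -/
def gThres (d : ℕ) (ℓ ε c δ Δf : ℝ) : ℝ :=
  √c / chi d ℓ ε c δ Δf ^ 2 * ε

/-- The function value threshold `f_thres = (c / χ³) · √(ε³ / ρ)`. -/
def fThres (d : ℕ) (ℓ ρ ε c δ Δf : ℝ) : ℝ :=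
  c / chi d ℓ ε c δ Δf ^ 3 * √(ε ^ 3 / ρ)

/-- The number of steps `t_thres = (χ / c²) · ℓ / √(ρ ε)` between two perturbations, rounded up to
an integer, since it is compared with differences of iteration counters. -/
def tThres (d : ℕ) (ℓ ρ ε c δ Δf : ℝ) : ℕ :=
  ⌈chi d ℓ ε c δ Δf / c ^ 2 * (ℓ / √(ρ * ε))⌉₊

/-! ### The algorithm -/

/-- The memory of the algorithm: the current iterate, the (unperturbed) iterate stored at the last
perturbation, and the time `t_noise` of the last perturbation. -/
structure Memory (d : ℕ) where
  x : Vec d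
  xTilde : Vec d
  tNoise : ℤ

/-- The algorithm is either still running or has returned a point. -/
inductive Status (d : ℕ) where
  | running (s : Memory d)
  | returned (y : Vec d)

/-- Initial memory: the iterate is `x₀` and `t_noise = -t_thres - 1`. The stored point is not read
before the first perturbation overwrites it. -/
def initMemory {d : ℕ} (x₀ : Vec d) (T : ℕ) : Memory d where
  x := x₀
  xTilde := x₀
  tNoise := -(T : ℤ) - 1

open Classical in
/-- First part of iteration `t`: if `‖∇f(x)‖ ≤ g` and `t - t_noise > T`, store `x`, set
`t_noise = t`, and add the perturbation `ξ` to `x`. -/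
def perturb {d : ℕ} (f : Vec d → ℝ) (g : ℝ) (T : ℕ) (t : ℕ) (ξ : Vec d) (s : Memory d) :
    Memory d :=
  if ‖gradient f s.x‖ ≤ g ∧ (t : ℤ) - s.tNoise > T then
    { x := s.x + ξ, xTilde := s.x, tNoise := t }
  else s

open Classical in
/-- Iteration `t` of the loop: perhaps perturb; then, if `t - t_noise = T` and the function value
has not dropped by `F` since the last perturbation, return the stored point; otherwise take a
gradient step of size `η`. -/
def iteration {d : ℕ} (f : Vec d → ℝ) (η g F : ℝ) (T : ℕ) (t : ℕ) (ξ : Vec d) (s : Memory d) :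
    Status d :=
  let s' := perturb f g T t ξ s
  if (t : ℤ) - s'.tNoise = T ∧ f s'.x - f s'.xTilde > -F then
    Status.returned s'.xTilde
  else
    Status.running { s' with x := s'.x - η • gradient f s'.x }

/-- The status after `n` iterations (those with `t = 0, …, n - 1`) of the loop, when the
perturbation available at time `t` is `ξ t`. -/
def loop {d : ℕ} (f : Vec d → ℝ) (x₀ : Vec d) (η g F : ℝ) (T : ℕ) (ξ : ℕ → Vec d) :
    ℕ → Status d
  | 0 => Status.running (initMemory x₀ T)
  | n + 1 =>
    match loop f x₀ η g F T ξ n with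
    | Status.running s => iteration f η g F T n (ξ n) s
    | Status.returned y => Status.returned y

/-- The status of perturbed gradient descent `PGD(x₀, ℓ, ρ, ε, c, δ, Δ_f)` on `f` after `n`
iterations. -/
def run {d : ℕ} (f : Vec d → ℝ) (x₀ : Vec d) (ℓ ρ ε c δ Δf : ℝ) (ξ : ℕ → Vec d) (n : ℕ) :
    Status d :=
  loop f x₀ (stepSize ℓ c) (gThres d ℓ ε c δ Δf) (fThres d ℓ ρ ε c δ Δf) (tThres d ℓ ρ ε c δ Δf)
    ξ n

/-- `ℓ (f(x₀) - f⋆) / ε² · log⁴ (d ℓ Δ_f / (ε² δ))`, where the logarithm is replaced by `1` when it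
is smaller than `1`. -/
def iterationRate (d : ℕ) (ℓ ε δ Δf gap : ℝ) : ℝ :=
  ℓ * gap / ε ^ 2 * max 1 (Real.log (d * ℓ * Δf / (ε ^ 2 * δ))) ^ 4

end PGD

end

noncomputable section

namespace PGD

open scoped RealInnerProductSpace

section

variable {d : ℕ} {f : Vec d → ℝ} {ℓ ρ : ℝ}

/-! ### Taylor estimates -/

/-! Write `ε = ρ s²`, `c = b²` and `γ = √(ρ ε) = ρ s`. Gradient steps never increase `f`, and a
trajectory that loses little value moves little (`IsSmooth.norm_iterate_sub_sq_le`). Near a saddle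
point, two such trajectories whose starting points differ by `w` along the most negative eigenvector
see almost the same Hessian, so their distance grows like `(1 + η γ) ^ n * w`. They cannot both
remain near the saddle, hence one of them loses value (`exists_decrease`). The stuck perturbations
therefore form a set that is thin in one direction, and packing disjoint translates bounds its share
of the ball by `3 d w / r` (`volume_le_of_thin`). Since `w` may be taken proportional to `exp (-2
χ)`, this share is a tiny number `p` (`cond_stuck_le`).

Every iteration of the algorithm, except those of an unfinished round after a perturbation, is
charged to a decrease of `f` (`Config.invariant`); this bounds the running time for all
perturbations whatsoever. A point is returned only if perturbing it did not gain `F = f_thres`, so a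
saddle point is returned only if a perturbation at a saddle point fails. Each perturbation is
independent of the past, so the failure probability is at most `p` times the expected number of
perturbed saddle points. That number never exceeds `(f x₀ - f⋆) / F`: each earlier perturbation has
cost `F`, and the last saddle point still lies `F` above `f⋆`. The choice of `χ` makes the product
at most `δ`. -/

lemma hasDerivAt_line (hf : Differentiable ℝ f) (x v : Vec d) (s : ℝ) :
    HasDerivAt (fun s : ℝ => f (x + s • v)) ⟪gradient f (x + s • v), v⟫ s := by
  have h1 : HasDerivAt (fun s : ℝ => x + s • v) v s := by
    simpa using ((hasDerivAt_id s).smul_const v).const_add x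
  have h2 := (hf (x + s • v)).hasFDerivAt.comp_hasDerivAt s h1
  rw [inner_gradient_left]
  exact h2

/-- Comparison of derivatives along a ray. The case `τ = 0` gives the descent lemma; the cubic term
is the Taylor remainder of a Lipschitz Hessian. -/
lemma le_of_inner_gradient_le (hf : Differentiable ℝ f) (x v : Vec d) {α β τ b : ℝ} (hb : 0 ≤ b)
    (h : ∀ s, 0 ≤ s → s ≤ b → ⟪gradient f (x + s • v), v⟫ ≤ α + β * s + τ * s ^ 2) :
    f (x + b • v) ≤ f x + α * b + β * b ^ 2 / 2 + τ * b ^ 3 / 3 := by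
  have hB : ∀ s : ℝ, HasDerivAt (fun s : ℝ => f x + α * s + β * s ^ 2 / 2 + τ * s ^ 3 / 3)
      (α + β * s + τ * s ^ 2) s := by
    intro s
    have h1 := ((hasDerivAt_id s).const_mul α).const_add (f x)
    have h2 := (((hasDerivAt_id s).pow 2).const_mul β).div_const 2
    have h3 := (((hasDerivAt_id s).pow 3).const_mul τ).div_const 3
    convert! (h1.add h2).add h3 using 1
    simp; ring
  refine image_le_of_deriv_right_le_deriv_boundary
    (f := fun s : ℝ => f (x + s • v)) (a := 0) (b := b)
    (fun s _ => (hasDerivAt_line hf x v s).continuousAt.continuousWithinAt)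
    (fun s _ => (hasDerivAt_line hf x v s).hasDerivWithinAt) (by simp)
    (fun s _ => (hB s).continuousAt.continuousWithinAt)
    (fun s _ => (hB s).hasDerivWithinAt) (fun s hs => h s hs.1 hs.2.le) ⟨hb, le_rfl⟩

/-- The descent lemma. -/
lemma IsSmooth.le_add (hf : IsSmooth ℓ f) (x v : Vec d) :
    f (x + v) ≤ f x + ⟪gradient f x, v⟫ + ℓ / 2 * ‖v‖ ^ 2 := by
  have := le_of_inner_gradient_le hf.1 x v (α := ⟪gradient f x, v⟫) (β := ℓ * ‖v‖ ^ 2) (τ := 0)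
    zero_le_one (fun s hs _ => by
      have h1 : ⟪gradient f (x + s • v) - gradient f x, v⟫ ≤ ℓ * ‖v‖ ^ 2 * s := by
        refine (real_inner_le_norm _ _).trans ?_
        have := hf.2 (x + s • v) x
        rw [add_sub_cancel_left, norm_smul, Real.norm_of_nonneg hs] at this
        nlinarith [norm_nonneg v]
      rw [inner_sub_left] at h1
      linarith)
  simp only [one_smul] at this
  linarith

/-! ### The Hessian -/

lemma IsHessianLipschitz.hessian_symm (hf : IsHessianLipschitz ρ f) (x v w : Vec d) :
    ⟪hessian f x v, w⟫ = ⟪v, hessian f x w⟫ := by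
  have h2 : HasFDerivAt (fun y => InnerProductSpace.toDual ℝ (Vec d) (gradient f y))
      ((InnerProductSpace.toDual ℝ (Vec d)).toContinuousLinearEquiv.toContinuousLinearMap.comp
        (hessian f x)) x :=
    ((InnerProductSpace.toDual ℝ (Vec d)).toContinuousLinearEquiv.toContinuousLinearMap.hasFDerivAt
      ).comp x (hf.2.1 x).hasFDerivAt
  have h := second_derivative_symmetric (f := f)
    (fun y => hasGradientAt_iff_hasFDerivAt.1 (hf.1 y).hasGradientAt) h2 v w
  rw [real_inner_comm (hessian f x w) v]
  simpa using h

lemma IsHessianLipschitz.isSymmetric (hf : IsHessianLipschitz ρ f) (x : Vec d) :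
    (hessian f x : Vec d →ₗ[ℝ] Vec d).IsSymmetric := fun v w => hf.hessian_symm x v w

lemma IsSmooth.norm_hessian_le (hℓ : 0 ≤ ℓ) (hf : IsSmooth ℓ f) (x : Vec d) :
    ‖hessian f x‖ ≤ ℓ := by
  refine norm_fderiv_le_of_lip' ℝ hℓ (Filter.Eventually.of_forall fun y => hf.2 y x)

lemma IsSmooth.continuous_gradient (hf : IsSmooth ℓ f) : Continuous (gradient f) := by
  refine (LipschitzWith.of_dist_le_mul (K := ℓ.toNNReal) fun x y => ?_).continuous
  rw [dist_eq_norm, dist_eq_norm]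
  exact (hf.2 x y).trans (mul_le_mul_of_nonneg_right (Real.le_coe_toNNReal ℓ) (norm_nonneg _))

lemma IsHessianLipschitz.continuous_hessian (hf : IsHessianLipschitz ρ f) :
    Continuous (hessian f) := by
  refine (LipschitzWith.of_dist_le_mul (K := ρ.toNNReal) fun x y => ?_).continuous
  rw [dist_eq_norm, dist_eq_norm]
  exact (hf.2.2 x y).trans (mul_le_mul_of_nonneg_right (Real.le_coe_toNNReal ρ) (norm_nonneg _))

/-- In a ball the gradient is close to its linearisation at the centre. -/
lemma IsHessianLipschitz.norm_gradient_sub_le (hρ : 0 ≤ ρ) (hf : IsHessianLipschitz ρ f)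
    {z x y : Vec d} {R : ℝ} (hx : ‖x - z‖ ≤ R) (hy : ‖y - z‖ ≤ R) :
    ‖gradient f y - gradient f x - hessian f z (y - x)‖ ≤ ρ * R * ‖y - x‖ := by
  refine (convex_closedBall z R).norm_image_sub_le_of_norm_fderiv_le'
    (fun u _ => hf.2.1 u) (fun u hu => ?_) (by simpa [dist_eq_norm] using hx)
    (by simpa [dist_eq_norm] using hy)
  refine (hf.2.2 u z).trans (mul_le_mul_of_nonneg_left ?_ hρ)
  simpa [dist_eq_norm] using hu

/-- The set of points where the Hessian has curvature below `-γ` in some direction. -/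
def saddleSet (γ : ℝ) (f : Vec d → ℝ) : Set (Vec d) :=
  {x | ∃ v : Vec d, ⟪hessian f x v, v⟫ < -γ * ‖v‖ ^ 2}

lemma IsHessianLipschitz.isOpen_saddleSet (hf : IsHessianLipschitz ρ f) (γ : ℝ) :
    IsOpen (saddleSet γ f) := by
  have : saddleSet γ f = ⋃ v : Vec d, {x | ⟪hessian f x v, v⟫ < -γ * ‖v‖ ^ 2} := by
    ext; simp [saddleSet]
  rw [this]
  refine isOpen_iUnion fun v => isOpen_lt ?_ continuous_const
  exact (hf.continuous_hessian.clm_apply continuous_const).inner continuous_const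

/-- At a saddle point the Hessian has a most negative eigenvalue, with a unit eigenvector. -/
lemma IsHessianLipschitz.exists_eigenvector (hf : IsHessianLipschitz ρ f) {γ : ℝ} {x : Vec d}
    (hx : x ∈ saddleSet γ f) : ∃ (μ : ℝ) (e : Vec d), γ < μ ∧ ‖e‖ = 1 ∧
      hessian f x e = -μ • e ∧ ∀ v, -μ * ‖v‖ ^ 2 ≤ ⟪hessian f x v, v⟫ := by
  obtain ⟨v, hv⟩ := hx
  have hv0 : v ≠ 0 := by rintro rfl; simp at hv
  have : Nontrivial (Vec d) := ⟨⟨v, 0, hv0⟩⟩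
  have hE := (hf.isSymmetric x).hasEigenvalue_iInf_of_finiteDimensional
  set m : ℝ := ⨅ x_1 : { x : Vec d // x ≠ 0 },
    RCLike.re ⟪(hessian f x : Vec d →ₗ[ℝ] Vec d) x_1, x_1⟫ / ‖(x_1 : Vec d)‖ ^ 2 with hm
  -- The real infimum bounds the Rayleigh quotients from below only once they are known to be
  -- bounded below.
  have hbdd : BddBelow (Set.range fun y : { y : Vec d // y ≠ 0 } =>
      RCLike.re ⟪(hessian f x : Vec d →ₗ[ℝ] Vec d) y, (y : Vec d)⟫ / ‖(y : Vec d)‖ ^ 2) := by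
    refine ⟨-‖hessian f x‖, ?_⟩
    rintro _ ⟨y, rfl⟩
    have := (abs_le.1 ((hessian f x).rayleighQuotient_le_norm (y : Vec d))).1
    simpa [ContinuousLinearMap.rayleighQuotient, ContinuousLinearMap.reApplyInnerSelf_apply]
      using this
  have hle : ∀ w : Vec d, m * ‖w‖ ^ 2 ≤ ⟪hessian f x w, w⟫ := by
    intro w
    by_cases hw : w = 0
    · simp [hw]
    · have h := ciInf_le hbdd ⟨w, hw⟩
      have hpos : 0 < ‖w‖ ^ 2 := by positivity
      exact (le_div_iff₀ hpos).1 h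
  obtain ⟨e, he⟩ := hE.exists_hasEigenvector
  have he0 : ‖e‖ ≠ 0 := norm_ne_zero_iff.2 he.2
  have heq : hessian f x e = m • e := he.apply_eq_smul
  refine ⟨-m, ‖e‖⁻¹ • e, ?_, ?_, ?_, fun w => by simpa using hle w⟩
  · have h1 := hle v
    have hpos : 0 < ‖v‖ ^ 2 := by positivity
    nlinarith
  · rw [norm_smul, norm_inv, norm_norm, inv_mul_cancel₀ he0]
  · rw [map_smul, heq, neg_neg, smul_comm]

/-- A point with small gradient that is not in the saddle set is second-order stationary. -/
lemma IsHessianLipschitz.isSecondOrderStationary (hd : 0 < d) (hf : IsHessianLipschitz ρ f)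
    {ε : ℝ} {x : Vec d} (hg : ‖gradient f x‖ ≤ ε) (hx : x ∉ saddleSet √(ρ * ε) f) :
    IsSecondOrderStationary ρ ε f x := by
  refine ⟨hg, ?_⟩
  have : Nonempty (Fin d) := ⟨⟨0, hd⟩⟩
  have : Nontrivial (Vec d) := inferInstance
  refine le_csInf ⟨_, (hf.isSymmetric x).hasEigenvalue_iInf_of_finiteDimensional⟩ ?_
  intro μ hμ
  obtain ⟨e, he⟩ := Module.End.HasEigenvalue.exists_hasEigenvector hμ
  by_contra! h
  refine hx ⟨e, ?_⟩
  have heq : hessian f x e = μ • e := he.apply_eq_smul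
  have hpos : 0 < ‖e‖ ^ 2 := by have := norm_pos_iff.2 he.2; positivity
  rw [heq, real_inner_smul_left, real_inner_self_eq_norm_sq]
  nlinarith

/-- A gradient step with the Hessian frozen expands by at most `1 + η μ`. -/
lemma norm_sub_smul_le {A : Vec d →L[ℝ] Vec d} (hA : (A : Vec d →ₗ[ℝ] Vec d).IsSymmetric)
    {η μ : ℝ} (hη : 0 ≤ η) (hμ : 0 ≤ μ) (hAℓ : ‖A‖ ≤ ℓ) (hηℓ : η * ℓ ≤ 1)
    (hAμ : ∀ v, -μ * ‖v‖ ^ 2 ≤ ⟪A v, v⟫) (v : Vec d) :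
    ‖v - η • A v‖ ≤ (1 + η * μ) * ‖v‖ := by
  have hB : ((ContinuousLinearMap.id ℝ (Vec d) - η • A : Vec d →L[ℝ] Vec d) :
      Vec d →ₗ[ℝ] Vec d).IsSymmetric := by
    intro x y
    have := hA x y
    simp only [ContinuousLinearMap.coe_coe] at this
    simp [inner_sub_left, inner_sub_right, inner_smul_left, inner_smul_right, this]
  have hn : ‖ContinuousLinearMap.id ℝ (Vec d) - η • A‖ ≤ 1 + η * μ := by
    -- The Rayleigh quotients of `1 - η A` lie between `1 - η ℓ ≥ 0` and `1 + η μ`.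
    rw [ContinuousLinearMap.norm_eq_iSup_rayleighQuotient _ hB]
    refine ciSup_le fun w => ?_
    rw [ContinuousLinearMap.rayleighQuotient, ContinuousLinearMap.reApplyInnerSelf_apply]
    by_cases hw : w = 0
    · simp [hw]; positivity
    have hpos : 0 < ‖w‖ ^ 2 := by have := norm_pos_iff.2 hw; positivity
    rw [abs_div, abs_of_pos hpos, div_le_iff₀ hpos]
    have h1 := hAμ w
    have h2 : ⟪A w, w⟫ ≤ ℓ * ‖w‖ ^ 2 := by
      refine (real_inner_le_norm _ _).trans ?_
      have := (A.le_opNorm w).trans (mul_le_mul_of_nonneg_right hAℓ (norm_nonneg _))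
      nlinarith [norm_nonneg w]
    have h3 : RCLike.re ⟪(ContinuousLinearMap.id ℝ (Vec d) - η • A) w, w⟫
        = ‖w‖ ^ 2 - η * ⟪A w, w⟫ := by
      simp [inner_sub_left, inner_smul_left]
    rw [h3, abs_le]
    constructor
    · nlinarith [mul_nonneg hη hμ, mul_le_mul_of_nonneg_left h2 hη]
    · nlinarith [mul_le_mul_of_nonneg_left h1 hη]
  simpa using ((ContinuousLinearMap.id ℝ (Vec d) - η • A).le_opNorm v).trans
    (mul_le_mul_of_nonneg_right hn (norm_nonneg _))

/-- The function value at a saddle point is well above the infimum. -/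
lemma IsHessianLipschitz.le_of_mem_saddleSet (hρ : 0 ≤ ρ) (hf : IsHessianLipschitz ρ f)
    {m γ s : ℝ} (hm : ∀ y, m ≤ f y) {x : Vec d} (hs : 0 ≤ s) (hx : x ∈ saddleSet γ f) :
    γ * s ^ 2 / 2 - ρ * s ^ 3 / 3 ≤ f x - m := by
  obtain ⟨μ, e₀, hμ, he₀, hHe₀, -⟩ := hf.exists_eigenvector hx
  -- The sign of the eigenvector is free, so the first-order term can be made nonpositive and
  -- dropped.
  obtain ⟨e, he, hHe, hge⟩ : ∃ e : Vec d, ‖e‖ = 1 ∧ hessian f x e = -μ • e ∧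
      ⟪gradient f x, e⟫ ≤ 0 := by
    rcases le_total ⟪gradient f x, e₀⟫ 0 with h | h
    · exact ⟨e₀, he₀, hHe₀, h⟩
    · exact ⟨-e₀, by simpa using he₀, by simp [hHe₀], by simpa using h⟩
  have := le_of_inner_gradient_le hf.1 x e (α := 0) (β := -γ) (τ := ρ) hs
    (fun t ht _ => by
      have hn : ‖t • e‖ = t := by rw [norm_smul, he, mul_one, Real.norm_of_nonneg ht]
      have h1 := hf.norm_gradient_sub_le hρ (z := x) (x := x) (y := x + t • e) (R := t)
        (by simpa using ht) (by simp [hn])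
      rw [add_sub_cancel_left, hn] at h1
      have h2 : ⟪gradient f (x + t • e) - gradient f x - hessian f x (t • e), e⟫ ≤ ρ * t ^ 2 := by
        refine (real_inner_le_norm _ _).trans ?_
        rw [he]; linarith
      rw [inner_sub_left, inner_sub_left, map_smul, hHe, real_inner_smul_left,
        real_inner_smul_left, real_inner_self_eq_norm_sq, he] at h2
      nlinarith)
  linarith [hm (x + s • e)]

end

section

variable {d : ℕ} {f : Vec d → ℝ} {ℓ ρ η : ℝ}

/-! ### Gradient descent -/

/-- One step of gradient descent. -/
def gdStep (f : Vec d → ℝ) (η : ℝ) (x : Vec d) : Vec d := x - η • gradient f x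

lemma IsSmooth.continuous_gdStep (hf : IsSmooth ℓ f) (η : ℝ) : Continuous (gdStep f η) :=
  continuous_id.sub (hf.continuous_gradient.const_smul η)

lemma IsSmooth.gdStep_le (hf : IsSmooth ℓ f) (hη : 0 ≤ η) (hηℓ : η * ℓ ≤ 1) (x : Vec d) :
    f (gdStep f η x) ≤ f x - η / 2 * ‖gradient f x‖ ^ 2 := by
  have h := hf.le_add x (-(η • gradient f x))
  rw [← sub_eq_add_neg, norm_neg, norm_smul, Real.norm_of_nonneg hη, inner_neg_right,
    real_inner_smul_right, real_inner_self_eq_norm_sq] at h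
  have : η * ℓ * (η * ‖gradient f x‖ ^ 2) ≤ 1 * (η * ‖gradient f x‖ ^ 2) := by gcongr
  rw [gdStep]
  nlinarith

lemma IsSmooth.gdStep_le_self (hf : IsSmooth ℓ f) (hη : 0 ≤ η) (hηℓ : η * ℓ ≤ 1) (x : Vec d) :
    f (gdStep f η x) ≤ f x := by
  have h := hf.gdStep_le hη hηℓ x
  have : 0 ≤ η / 2 * ‖gradient f x‖ ^ 2 := by positivity
  linarith

lemma IsSmooth.iterate_antitone (hf : IsSmooth ℓ f) (hη : 0 ≤ η) (hηℓ : η * ℓ ≤ 1) (x : Vec d) :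
    Antitone fun n => f ((gdStep f η)^[n] x) := by
  refine antitone_nat_of_succ_le fun n => ?_
  rw [Function.iterate_succ_apply']
  exact hf.gdStep_le_self hη hηℓ _

/-- Cauchy–Schwarz for `√t √A + 1 √B`. It is the induction step that bounds the squared displacement
by the number of steps times the total decrease. -/
lemma add_sq_le_of_sq_le {a b t A B : ℝ} (ht : 0 ≤ t) (hA : 0 ≤ A)
    (ha : a ^ 2 ≤ t * A) (hb : b ^ 2 ≤ B) : (a + b) ^ 2 ≤ (t + 1) * (A + B) := by
  have hB : 0 ≤ B := (sq_nonneg b).trans hb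
  have h : 2 * a * b ≤ A + t * B := by
    refine le_of_abs_le (abs_le_of_sq_le_sq ?_ (by positivity))
    have := mul_le_mul ha hb (sq_nonneg b) (by positivity)
    nlinarith [sq_nonneg (A - t * B)]
  nlinarith

/-- Gradient descent either decreases the function or stays local. -/
lemma IsSmooth.norm_iterate_sub_sq_le (hf : IsSmooth ℓ f) (hη : 0 ≤ η) (hηℓ : η * ℓ ≤ 1)
    (x : Vec d) (n : ℕ) :
    ‖(gdStep f η)^[n] x - x‖ ^ 2 ≤ 2 * η * n * (f x - f ((gdStep f η)^[n] x)) := by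
  induction n with
  | zero => simp
  | succ n ih =>
    set y := (gdStep f η)^[n] x with hy
    have hstep := hf.gdStep_le hη hηℓ y
    have hanti := hf.iterate_antitone hη hηℓ x (Nat.zero_le n)
    simp only [Function.iterate_zero, id, ← hy] at hanti
    rw [Function.iterate_succ_apply', ← hy]
    have h1 : ‖gdStep f η y - x‖ ≤ ‖y - x‖ + η * ‖gradient f y‖ := by
      have : gdStep f η y - x = (y - x) - η • gradient f y := by rw [gdStep]; abel
      rw [this]
      refine (norm_sub_le _ _).trans_eq ?_
      rw [norm_smul, Real.norm_of_nonneg hη]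
    have h2 := add_sq_le_of_sq_le (a := ‖y - x‖) (b := η * ‖gradient f y‖) (t := n)
      (A := 2 * η * (f x - f y)) (B := 2 * η * (f y - f (gdStep f η y))) (by positivity)
      (mul_nonneg (by positivity) (by linarith)) (by linarith) (by nlinarith)
    calc ‖gdStep f η y - x‖ ^ 2 ≤ (‖y - x‖ + η * ‖gradient f y‖) ^ 2 := by gcongr
      _ ≤ _ := h2
      _ = _ := by push_cast; ring

/-- Two gradient descent sequences that start at distance `w` along the most negative eigenvector
at `z` and stay near `z` separate exponentially. -/
lemma norm_iterate_sub_iterate_le (hη : 0 ≤ η) (hρ : 0 ≤ ρ)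
    (hf : IsHessianLipschitz ρ f) {z e u : Vec d} {μ w R : ℝ} (hw : 0 ≤ w) (he : ‖e‖ = 1)
    (hμ : 0 ≤ μ) (hHe : hessian f z e = -μ • e) (hR : 0 ≤ R)
    (hexp : ∀ v, ‖v - η • hessian f z v‖ ≤ (1 + η * μ) * ‖v‖) {n : ℕ}
    (hn : 2 * (η * ρ * R) * n ≤ 1)
    (hu : ∀ t < n, ‖(gdStep f η)^[t] u - z‖ ≤ R)
    (hu' : ∀ t < n, ‖(gdStep f η)^[t] (u + w • e) - z‖ ≤ R) :
    ∀ t ≤ n, ‖(gdStep f η)^[t] (u + w • e) - (gdStep f η)^[t] u - ((1 + η * μ) ^ t * w) • e‖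
      ≤ 2 * (η * ρ * R) * t * ((1 + η * μ) ^ t * w) := by
  intro t
  induction t with
  | zero => intro; simp
  | succ t ih =>
    intro ht
    have ih := ih (by omega)
    rw [Function.iterate_succ_apply', Function.iterate_succ_apply']
    set x := (gdStep f η)^[t] u
    set y := (gdStep f η)^[t] (u + w • e)
    set q := 1 + η * μ with hq
    set θ := η * ρ * R with hθ
    have hθ0 : 0 ≤ θ := by positivity
    have hq1 : 1 ≤ q := by have := mul_nonneg hη hμ; linarith
    set p := q ^ t * w with hp
    have hp0 : 0 ≤ p := by positivity
    have hgrad := hf.norm_gradient_sub_le hρ (hu t (by omega)) (hu' t (by omega))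
    -- With the Hessian frozen at `z`, the main term is multiplied by exactly `q`. What remains is
    -- the propagated error and the linearisation defect of the gradient.
    have hdec : gdStep f η y - gdStep f η x - (q ^ (t + 1) * w) • e
        = ((y - x - p • e) - η • hessian f z (y - x - p • e))
          - η • (gradient f y - gradient f x - hessian f z (y - x)) := by
      have : (q ^ (t + 1) * w) = p + η * μ * p := by rw [hp, pow_succ, hq]; ring
      rw [this, map_sub, map_smul, hHe, gdStep, gdStep]
      module
    have hyx : ‖y - x‖ ≤ 2 * θ * t * p + p := by
      have : y - x = (y - x - p • e) + p • e := by abel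
      rw [this]
      refine (norm_add_le _ _).trans (add_le_add ih ?_)
      rw [norm_smul, he, mul_one, Real.norm_of_nonneg hp0]
    rw [hdec]
    have ht1 : 2 * θ * t ≤ 1 := by
      refine le_trans ?_ hn
      gcongr
      omega
    calc _ ≤ q * (2 * θ * t * p) + θ * (2 * θ * t * p + p) := by
          refine (norm_sub_le _ _).trans (add_le_add ((hexp _).trans ?_) ?_)
          · gcongr
          · rw [norm_smul, Real.norm_of_nonneg hη]
            calc _ ≤ η * (ρ * R * ‖y - x‖) := by gcongr
              _ = θ * ‖y - x‖ := by rw [hθ]; ring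
              _ ≤ _ := by gcongr
      _ ≤ q * (2 * θ * t * p) + θ * (2 * p) := by gcongr; nlinarith
      _ ≤ q * (2 * θ * t * p) + q * (θ * (2 * p)) := by
          exact add_le_add le_rfl (le_mul_of_one_le_left (by positivity) hq1)
      _ = _ := by push_cast; rw [pow_succ, hp]; ring

/-- If two starting points near a saddle point differ by more than `4 R / (1 + η γ) ^ n` along the
most negative eigenvector, then gradient descent from one of them decreases the function. -/
lemma exists_decrease (hη : 0 ≤ η) (hηℓ : η * ℓ ≤ 1) (hℓ : 0 ≤ ℓ) (hρ : 0 ≤ ρ)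
    (hs : IsSmooth ℓ f) (hf : IsHessianLipschitz ρ f) {z e u : Vec d} {μ γ w r S D : ℝ}
    (hγ : 0 ≤ γ) (hγμ : γ ≤ μ) (hw : 0 ≤ w) (he : ‖e‖ = 1)
    (hHe : hessian f z e = -μ • e) (hHμ : ∀ v, -μ * ‖v‖ ^ 2 ≤ ⟪hessian f z v, v⟫)
    (hS : 0 ≤ S) (hr : 0 ≤ r) {n : ℕ}
    (hn : 4 * (η * ρ * (S + r)) * n ≤ 1) (hSD : 2 * η * n * D ≤ S ^ 2)
    (hu : ‖u - z‖ ≤ r) (hu' : ‖u + w • e - z‖ ≤ r)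
    (hwn : 4 * (S + r) < (1 + η * γ) ^ n * w) :
    D < f u - f ((gdStep f η)^[n] u) ∨
      D < f (u + w • e) - f ((gdStep f η)^[n] (u + w • e)) := by
  by_contra! hcon
  -- Improve or localise: a trajectory that loses at most `D` moves by at most `S`.
  have key : ∀ v : Vec d, f v - f ((gdStep f η)^[n] v) ≤ D → ‖v - z‖ ≤ r → ∀ t ≤ n,
      ‖(gdStep f η)^[t] v - z‖ ≤ S + r := by
    intro v hv hvr t ht
    have h1 : ‖(gdStep f η)^[t] v - v‖ ≤ S := by
      refine le_of_sq_le_sq ?_ hS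
      refine (hs.norm_iterate_sub_sq_le hη hηℓ v t).trans (le_trans ?_ hSD)
      have h2 : f ((gdStep f η)^[n] v) ≤ f ((gdStep f η)^[t] v) :=
        hs.iterate_antitone hη hηℓ v ht
      have h3 : f ((gdStep f η)^[t] v) ≤ f v :=
        hs.iterate_antitone hη hηℓ v (Nat.zero_le t)
      have h4 : (t : ℝ) ≤ n := by exact_mod_cast ht
      refine mul_le_mul (by gcongr) (by linarith) (by linarith) (by positivity)
    calc _ = ‖((gdStep f η)^[t] v - v) + (v - z)‖ := by congr 1; abel
      _ ≤ _ := (norm_add_le _ _).trans (add_le_add h1 hvr)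
  have k1 := key u hcon.1 hu
  have k2 := key _ hcon.2 hu'
  have hμ : 0 ≤ μ := hγ.trans hγμ
  have hmain := norm_iterate_sub_iterate_le hη hρ hf hw he hμ hHe (by positivity)
    (norm_sub_smul_le (hf.isSymmetric z) hη hμ (hs.norm_hessian_le hℓ z) hηℓ hHμ)
    (n := n) (R := S + r) (by nlinarith [show 0 ≤ η * ρ * (S + r) * n by positivity])
    (fun t ht => k1 t ht.le) (fun t ht => k2 t ht.le) n le_rfl
  set a := (gdStep f η)^[n] u
  set b := (gdStep f η)^[n] (u + w • e)
  set p := (1 + η * μ) ^ n * w with hp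
  have hp0 : 0 ≤ p := by positivity
  have h1 : p ≤ ‖b - a - p • e‖ + ‖b - a‖ := by
    have h : ‖p • e‖ = p := by rw [norm_smul, he, mul_one, Real.norm_of_nonneg hp0]
    calc p = ‖(b - a) - (b - a - p • e)‖ := by rw [sub_sub_cancel, h]
      _ ≤ _ := by rw [add_comm]; exact norm_sub_le _ _
  have h2 : ‖b - a‖ ≤ 2 * (S + r) := by
    calc ‖b - a‖ = ‖(b - z) - (a - z)‖ := by congr 1; abel
      _ ≤ ‖b - z‖ + ‖a - z‖ := norm_sub_le _ _
      _ ≤ _ := by linarith [k1 n le_rfl, k2 n le_rfl]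
  -- The error is at most half of the main term `p`, so the distance is at least `p / 2 > 2 (S +
  -- r)`, against `h2`.
  have h3 : 2 * (η * ρ * (S + r)) * n * p ≤ 1 / 2 * p := by
    gcongr; linarith
  have h4 : (1 + η * γ) ^ n * w ≤ p := by rw [hp]; gcongr
  linarith

end

section

variable {d : ℕ} {f : Vec d → ℝ} {ℓ ρ : ℝ}

/-! ### The stuck region is thin -/

/-- The bound `exp (x / 2) ≤ 1 + x` on `[0, 1]` costs a factor two in the exponent. -/
lemma exp_le_one_add_pow {x y : ℝ} {n : ℕ} (hx : 0 ≤ x) (hx1 : x ≤ 1) (h : 2 * y ≤ x * n) :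
    Real.exp y ≤ (1 + x) ^ n := by
  have h1 : Real.exp (x / 2) ≤ 1 + x := by
    refine (Real.exp_bound_div_one_sub_of_interval (x := x / 2) (by positivity)
      (by linarith)).trans ?_
    rw [div_le_iff₀ (by linarith)]
    nlinarith
  calc Real.exp y ≤ Real.exp (n * (x / 2)) := by
        apply Real.exp_le_exp.2; linarith
    _ = Real.exp (x / 2) ^ n := by rw [Real.exp_nat_mul]
    _ ≤ _ := by gcongr

/-- The perturbation of a point with small gradient increases the function only slightly. -/
lemma IsSmooth.le_add_of_norm_le (hf : IsSmooth ℓ f) {χ b s : ℝ} (hχ : 12 ≤ χ) (hb : 0 < b)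
    (hs : 0 < s) (hρ : 0 < ρ) (hℓ : 0 < ℓ) (hsℓ : ρ * s ≤ ℓ) {z ζ : Vec d}
    (hg : ‖gradient f z‖ ≤ b / χ ^ 2 * (ρ * s ^ 2))
    (hζ : ‖ζ‖ ≤ b / χ ^ 2 * (ρ * s ^ 2 / ℓ)) :
    f (z + ζ) ≤ f z + b ^ 2 / χ ^ 3 * (ρ * s ^ 3) := by
  have hχ0 : 0 < χ := by linarith
  set F := b ^ 2 / χ ^ 3 * (ρ * s ^ 3) with hF
  set r := b / χ ^ 2 * (ρ * s ^ 2 / ℓ) with hr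
  have h1 := hf.le_add z ζ
  have h2 : ⟪gradient f z, ζ⟫ ≤ b / χ ^ 2 * (ρ * s ^ 2) * r :=
    (real_inner_le_norm _ _).trans (mul_le_mul hg hζ (norm_nonneg _) (by positivity))
  have h3 : ℓ / 2 * ‖ζ‖ ^ 2 ≤ ℓ / 2 * r ^ 2 := by gcongr
  have h4 : b / χ ^ 2 * (ρ * s ^ 2) * r + ℓ / 2 * r ^ 2
      = F * (3 / 2 * (ρ * s / ℓ) / χ) := by
    rw [hr, hF]; field_simp; ring
  have h5 : 3 / 2 * (ρ * s / ℓ) / χ ≤ 1 := by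
    have : ρ * s / ℓ ≤ 1 := (div_le_one hℓ).2 hsℓ
    rw [div_le_one hχ0]; linarith
  have h6 : F * (3 / 2 * (ρ * s / ℓ) / χ) ≤ F * 1 := by gcongr
  linarith

/-- With the parameters of perturbed gradient descent (`ε = ρ s²`, `c = b²`), two points of the
perturbation ball around a saddle point that are far apart along the most negative eigenvector
cannot both be stuck. -/
lemma exists_thin_direction {χ b s : ℝ} {T : ℕ} (hχ : 12 ≤ χ) (hb : 0 < b) (hb' : b ≤ 1 / 256)
    (hs : 0 < s) (hρ : 0 < ρ) (hℓ : 0 < ℓ) (hsℓ : ρ * s ≤ ℓ) (hf : IsSmooth ℓ f)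
    (hH : IsHessianLipschitz ρ f) (hT : χ / b ^ 4 * (ℓ / (ρ * s)) ≤ T) {z : Vec d}
    (hg : ‖gradient f z‖ ≤ b / χ ^ 2 * (ρ * s ^ 2)) (hz : z ∈ saddleSet (ρ * s) f) :
    ∃ e : Vec d, ‖e‖ = 1 ∧ ∀ (ξ : Vec d) (w : ℝ), 28 * (b * s / χ) * Real.exp (-2 * χ) ≤ w →
      ‖ξ‖ ≤ b / χ ^ 2 * (ρ * s ^ 2 / ℓ) → ‖ξ + w • e‖ ≤ b / χ ^ 2 * (ρ * s ^ 2 / ℓ) →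
      f ((gdStep f (b ^ 2 / ℓ))^[T] (z + ξ)) ≤ f z - b ^ 2 / χ ^ 3 * (ρ * s ^ 3) ∨
      f ((gdStep f (b ^ 2 / ℓ))^[T] (z + (ξ + w • e))) ≤ f z - b ^ 2 / χ ^ 3 * (ρ * s ^ 3) := by
  obtain ⟨μ, e, hμ, he, hHe, hHμ⟩ := hH.exists_eigenvector hz
  refine ⟨e, he, fun ξ w hw hξ hξ' => ?_⟩
  have hχ0 : 0 < χ := by linarith
  set η := b ^ 2 / ℓ with hη
  have hη0 : 0 < η := by positivity
  have hηℓ : η * ℓ = b ^ 2 := by rw [hη]; field_simp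
  have hb2 : b ^ 2 ≤ 1 / 256 := by nlinarith
  set F := b ^ 2 / χ ^ 3 * (ρ * s ^ 3) with hF
  set r := b / χ ^ 2 * (ρ * s ^ 2 / ℓ) with hr
  -- The localisation scale: losing about `F` over about `χ / (η γ)` steps permits a displacement of
  -- order `√(η n F)`, which is of order `σ`.
  set σ := b * s / χ with hσ
  have hσ0 : 0 < σ := by positivity
  have hr0 : 0 < r := by positivity
  have hrσ : r ≤ σ / 12 := by
    have h1 : ρ * s ^ 2 / ℓ ≤ s := by rw [div_le_iff₀ hℓ]; nlinarith
    calc r ≤ b / χ ^ 2 * s := by rw [hr]; gcongr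
      _ = σ / χ := by rw [hσ]; field_simp
      _ ≤ σ / 12 := by gcongr
  have hinc : ∀ ζ : Vec d, ‖ζ‖ ≤ r → f (z + ζ) ≤ f z + F := fun ζ hζ =>
    hf.le_add_of_norm_le hχ hb hs hρ hℓ hsℓ hg hζ
  -- `N = χ / (η γ)`. Taking `n` between `4 N` and `8 N` gives growth at least `exp (2 χ)`, and `n ≤
  -- T` because `T ≥ N / b²`.
  set N := χ * ℓ / (b ^ 2 * (ρ * s)) with hN
  have hN1 : 1 ≤ N := by
    rw [hN, one_le_div (by positivity)]
    exact mul_le_mul (by linarith) hsℓ (by positivity) hχ0.le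
  set n := ⌈4 * N⌉₊ with hn
  have hn1 : 4 * N ≤ n := Nat.le_ceil _
  have hn2 : (n : ℝ) ≤ 8 * N := by
    have := (Nat.ceil_lt_add_one (a := 4 * N) (by linarith)).le
    rw [← hn] at this
    linarith
  have hnT : n ≤ T := by
    refine Nat.ceil_le.2 (le_trans ?_ hT)
    have : χ / b ^ 4 * (ℓ / (ρ * s)) = N / b ^ 2 := by rw [hN]; field_simp
    rw [this, le_div_iff₀ (by positivity)]
    have := mul_le_mul_of_nonneg_left hb2 (show 0 ≤ N by linarith)
    linarith
  have hNη : η * (ρ * s) * N = χ := by rw [hN, hη]; field_simp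
  have hm1 : 4 * χ ≤ η * (ρ * s) * n := by
    rw [← hNη]
    have := mul_le_mul_of_nonneg_left hn1 (show 0 ≤ η * (ρ * s) by positivity)
    linarith
  have hm2 : η * (ρ * s) * n ≤ 8 * χ := by
    rw [← hNη]
    have := mul_le_mul_of_nonneg_left hn2 (show 0 ≤ η * (ρ * s) by positivity)
    linarith
  have hexp : Real.exp (2 * χ) ≤ (1 + η * (ρ * s)) ^ n := by
    refine exp_le_one_add_pow (by positivity) ?_ (by linarith)
    calc η * (ρ * s) ≤ η * ℓ := by gcongr
      _ ≤ 1 := by linarith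
  have hww : 28 * σ ≤ (1 + η * (ρ * s)) ^ n * w := by
    calc 28 * σ = Real.exp (2 * χ) * (28 * σ * Real.exp (-2 * χ)) := by
          rw [mul_left_comm, ← Real.exp_add]; simp
      _ ≤ _ := by gcongr
  -- `D = 2 F` pays for the increase `F` caused by the perturbation and leaves a decrease `F`. `S =
  -- 6 σ` works since `32 ≤ 6²`, and `28 σ` exceeds `4 (S + r)` since `r ≤ σ / 12`.
  have hdec := exists_decrease (z := z) (e := e) (u := z + ξ) (w := w) (γ := ρ * s) (μ := μ)
    (r := r) (S := 6 * σ) (D := 2 * F) (n := n) hη0.le (by linarith) hℓ.le hρ.le hf hH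
    (by positivity) hμ.le (le_trans (by positivity) hw) he hHe hHμ (by positivity) hr0.le
    (by
      calc 4 * (η * ρ * (6 * σ + r)) * n ≤ 4 * (η * ρ * (6 * σ + σ / 12)) * n := by gcongr
        _ = 4 * (6 + 1 / 12) * (η * (ρ * s) * n) * (b / χ) := by rw [hσ]; field_simp
        _ ≤ 4 * (6 + 1 / 12) * (8 * χ) * (b / χ) := by gcongr
        _ = 4 * (6 + 1 / 12) * 8 * b := by field_simp
        _ ≤ 1 := by linarith)
    (by
      calc 2 * η * n * (2 * F) = 4 * (η * (ρ * s) * n) * (b ^ 2 * s ^ 2 / χ ^ 3) := by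
            rw [hF]; field_simp; ring
        _ ≤ 4 * (8 * χ) * (b ^ 2 * s ^ 2 / χ ^ 3) := by gcongr
        _ = 32 * σ ^ 2 := by rw [hσ]; field_simp; ring
        _ ≤ _ := by nlinarith [sq_nonneg σ])
    (by simpa using hξ) (by rwa [add_assoc, add_sub_cancel_left]) (by linarith)
  have hmono : ∀ v : Vec d, f ((gdStep f η)^[T] v) ≤ f ((gdStep f η)^[n] v) := fun v =>
    hf.iterate_antitone hη0.le (by linarith) v hnT
  rcases hdec with h | h
  · left
    linarith [hmono (z + ξ), hinc ξ hξ]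
  · right
    rw [add_assoc] at h
    linarith [hmono (z + (ξ + w • e)), hinc _ hξ']

/-- A subset of a ball that is thin in one direction has small volume. -/
lemma volume_le_of_thin {A : Set (Vec d)} (hA : MeasurableSet A) (hd : 0 < d) {r w : ℝ}
    (hr : 0 < r) (hw : 0 < w) (hAr : A ⊆ Metric.closedBall 0 r) {e : Vec d} (he : ‖e‖ = 1)
    (hthin : ∀ x ∈ A, ∀ t, w ≤ t → x + t • e ∉ A) :
    volume A ≤ ENNReal.ofReal (3 * d * w / r) * volume (Metric.closedBall (0 : Vec d) r) := by
  have hd0 : (0 : ℝ) < d := by exact_mod_cast hd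
  -- The shifts `0, w, …, (K - 1) w` do not exceed `r / d`, so all translates lie in a ball whose
  -- volume is larger by a factor of at most `(1 + 1/d) ^ d ≤ 3`.
  set K := ⌊r / (d * w)⌋₊ + 1 with hK
  have hK1 : r / (d * w) ≤ K := by rw [hK]; push_cast; exact (Nat.lt_floor_add_one _).le
  let B : ℕ → Set (Vec d) := fun k => (fun x => x + (k * w) • e) '' A
  have hBmeas : ∀ k, MeasurableSet (B k) := fun k =>
    (MeasurableEquiv.addRight ((k * w) • e)).measurableSet_image.2 hA
  have hBvol : ∀ k, volume (B k) = volume A := fun k => by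
    simp only [B, Set.image_add_right, measure_preimage_add_right]
  have hlt : ∀ i j : ℕ, i < j → Disjoint (B i) (B j) := by
    intro i j hij
    rw [Set.disjoint_left]
    rintro _ ⟨x, hx, rfl⟩ ⟨y, hy, hxy⟩
    have hxy' : x = y + ((j - i : ℝ) * w) • e := by
      have : x = y + (j * w) • e - (i * w) • e := by rw [eq_sub_iff_add_eq]; exact hxy.symm
      rw [this]; module
    refine hthin y hy _ ?_ (hxy' ▸ hx)
    have : (i : ℝ) + 1 ≤ j := by exact_mod_cast hij
    nlinarith
  have hdisj : Pairwise (Function.onFun Disjoint B) := fun i j hij =>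
    hij.lt_or_gt.elim (hlt i j) fun h => (hlt j i h).symm
  have hsub : (⋃ k ∈ Finset.range K, B k) ⊆ Metric.closedBall 0 ((1 + 1 / d) * r) := by
    refine Set.iUnion₂_subset fun k hk => ?_
    rintro _ ⟨x, hx, rfl⟩
    have hxr := hAr hx
    rw [mem_closedBall_zero_iff] at hxr ⊢
    have hk' : (k : ℝ) ≤ r / (d * w) := by
      have : k ≤ ⌊r / (d * w)⌋₊ := by have := Finset.mem_range.1 hk; omega
      exact (Nat.cast_le.2 this).trans (Nat.floor_le (by positivity))
    refine (norm_add_le _ _).trans ?_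
    rw [norm_smul, he, mul_one, Real.norm_of_nonneg (by positivity)]
    have h1 : k * w ≤ r / (d * w) * w := by gcongr
    have h2 : r / (d * w) * w = 1 / d * r := by field_simp
    linarith
  have hsum : (K : ENNReal) * volume A ≤ 3 * volume (Metric.closedBall (0 : Vec d) r) := by
    calc (K : ENNReal) * volume A = ∑ k ∈ Finset.range K, volume (B k) := by simp [hBvol]
      _ = volume (⋃ k ∈ Finset.range K, B k) :=
          (measure_biUnion_finset (fun i _ j _ hij => hdisj hij) fun k _ => hBmeas k).symm
      _ ≤ volume (Metric.closedBall (0 : Vec d) ((1 + 1 / d) * r)) := measure_mono hsub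
      _ = ENNReal.ofReal ((1 + 1 / d) ^ d) * volume (Metric.closedBall (0 : Vec d) r) := by
          rw [Measure.addHaar_closedBall_mul _ _ (by positivity) hr.le, finrank_euclideanSpace_fin]
      _ ≤ _ := by
          gcongr
          rw [← ENNReal.ofReal_ofNat]
          refine ENNReal.ofReal_le_ofReal ?_
          calc (1 + 1 / (d : ℝ)) ^ d ≤ Real.exp (1 / d) ^ d := by
                gcongr; rw [add_comm]; exact Real.add_one_le_exp _
            _ = Real.exp 1 := by rw [← Real.exp_nat_mul]; congr 1; field_simp
            _ ≤ 3 := Real.exp_one_lt_three.le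
  have hKw : 1 ≤ d * w / r * K := by
    calc 1 = d * w / r * (r / (d * w)) := by field_simp
      _ ≤ _ := by gcongr
  calc volume A = 1 * volume A := (one_mul _).symm
    _ ≤ ENNReal.ofReal (d * w / r * K) * volume A := by
        gcongr; rw [← ENNReal.ofReal_one]; exact ENNReal.ofReal_le_ofReal hKw
    _ = ENNReal.ofReal (d * w / r) * (K * volume A) := by
        rw [ENNReal.ofReal_mul (by positivity), ENNReal.ofReal_natCast, mul_assoc]
    _ ≤ ENNReal.ofReal (d * w / r) * (3 * volume (Metric.closedBall (0 : Vec d) r)) := by gcongr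
    _ = _ := by
        rw [← mul_assoc, ← ENNReal.ofReal_ofNat, ← ENNReal.ofReal_mul (by positivity)]
        congr 2; ring

/-- A uniform perturbation of a saddle point is stuck with small probability. -/
lemma cond_stuck_le (hd : 0 < d) {χ b s : ℝ} {T : ℕ} (hχ : 12 ≤ χ) (hb : 0 < b)
    (hb' : b ≤ 1 / 256) (hs : 0 < s) (hρ : 0 < ρ) (hℓ : 0 < ℓ) (hsℓ : ρ * s ≤ ℓ)
    (hf : IsSmooth ℓ f) (hH : IsHessianLipschitz ρ f) (hT : χ / b ^ 4 * (ℓ / (ρ * s)) ≤ T)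
    {z : Vec d} (hg : ‖gradient f z‖ ≤ b / χ ^ 2 * (ρ * s ^ 2)) (hz : z ∈ saddleSet (ρ * s) f) :
    (volume : Measure (Vec d))[|Metric.closedBall 0 (b / χ ^ 2 * (ρ * s ^ 2 / ℓ))]
      {ξ | f z - b ^ 2 / χ ^ 3 * (ρ * s ^ 3) < f ((gdStep f (b ^ 2 / ℓ))^[T] (z + ξ))}
      ≤ ENNReal.ofReal (84 * χ * Real.exp (-2 * χ) * (d * (ℓ / (ρ * s)))) := by
  obtain ⟨e, he, hthin⟩ := exists_thin_direction hχ hb hb' hs hρ hℓ hsℓ hf hH hT hg hz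
  have hχ0 : 0 < χ := by linarith
  set r := b / χ ^ 2 * (ρ * s ^ 2 / ℓ) with hr
  have hr0 : 0 < r := by positivity
  set A : Set (Vec d) :=
    {ξ | f z - b ^ 2 / χ ^ 3 * (ρ * s ^ 3) < f ((gdStep f (b ^ 2 / ℓ))^[T] (z + ξ))} with hAdef
  have hA : MeasurableSet A := by
    refine (isOpen_lt continuous_const ?_).measurableSet
    exact hf.1.continuous.comp (((hf.continuous_gdStep _).iterate T).comp
      (continuous_const.add continuous_id))
  have hvol := volume_le_of_thin (A := Metric.closedBall 0 r ∩ A)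
    (measurableSet_closedBall.inter hA) hd hr0
    (w := 28 * (b * s / χ) * Real.exp (-2 * χ)) (by positivity) Set.inter_subset_left he
    (by
      rintro x ⟨hx, hxA⟩ t ht ⟨hy, hyA⟩
      rw [mem_closedBall_zero_iff] at hx hy
      rcases hthin x t ht hx hy with h | h
      · exact absurd hxA (not_lt.2 h)
      · exact absurd hyA (not_lt.2 h))
  rw [cond_apply measurableSet_closedBall]
  have hB0 : volume (Metric.closedBall (0 : Vec d) r) ≠ 0 :=
    (Metric.measure_closedBall_pos _ _ hr0).ne'
  have hB1 : volume (Metric.closedBall (0 : Vec d) r) ≠ ⊤ := measure_closedBall_lt_top.ne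
  rw [mul_comm, ← div_eq_mul_inv, ENNReal.div_le_iff hB0 hB1]
  refine hvol.trans_eq ?_
  congr 2
  rw [hr]; field_simp; ring

end

section

variable {d : ℕ}

/-! ### The trajectory of perturbed gradient descent -/

/-- The data of a run of the loop, apart from the perturbations. -/
structure Config (d : ℕ) where
  f : Vec d → ℝ
  x₀ : Vec d
  η : ℝ
  g : ℝ
  F : ℝ
  T : ℕ

namespace Config

variable (A : Config d) (u : ℕ → Vec d)

/-- The memory before iteration `n` when no iteration returns. -/
def mem : ℕ → Memory d
  | 0 => initMemory A.x₀ A.T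
  | n + 1 => { perturb A.f A.g A.T n (u n) (mem n) with
      x := gdStep A.f A.η (perturb A.f A.g A.T n (u n) (mem n)).x }

/-- Iteration `n` returns. -/
def Returns (n : ℕ) : Prop :=
  (n : ℤ) - (perturb A.f A.g A.T n (u n) (A.mem u n)).tNoise = A.T ∧
    A.f (perturb A.f A.g A.T n (u n) (A.mem u n)).x
      - A.f (perturb A.f A.g A.T n (u n) (A.mem u n)).xTilde > -A.F

/-- No iteration before `n` returns. -/
def Alive (n : ℕ) : Prop := ∀ k < n, ¬ A.Returns u k

/-- Iteration `n` perturbs the iterate. -/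
def Perturbs (n : ℕ) : Prop :=
  ‖gradient A.f (A.mem u n).x‖ ≤ A.g ∧ (n : ℤ) - (A.mem u n).tNoise > A.T

/-- Iteration `n` is reached and perturbs a point of `S`. -/
def Hits (S : Set (Vec d)) (n : ℕ) : Prop :=
  A.Alive u n ∧ A.Perturbs u n ∧ (A.mem u n).x ∈ S

open Classical in
/-- The number of perturbations of points of `S` before iteration `n`. -/
def hitCount (S : Set (Vec d)) (n : ℕ) : ℕ := ((Finset.range n).filter (A.Hits u S)).card

variable {A u}

lemma perturb_of_perturbs {n : ℕ} (h : A.Perturbs u n) :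
    perturb A.f A.g A.T n (u n) (A.mem u n)
      = { x := (A.mem u n).x + u n, xTilde := (A.mem u n).x, tNoise := n } := if_pos h

lemma perturb_of_not_perturbs {n : ℕ} (h : ¬ A.Perturbs u n) :
    perturb A.f A.g A.T n (u n) (A.mem u n) = A.mem u n := if_neg h

lemma loop_of_alive {n : ℕ} (h : A.Alive u n) :
    loop A.f A.x₀ A.η A.g A.F A.T u n = Status.running (A.mem u n) := by
  induction n with
  | zero => rfl
  | succ n ih =>
    rw [loop, ih fun k hk => h k (by omega)]
    exact if_neg (h n (by omega))

lemma loop_of_returns {n : ℕ} (h : A.Alive u n) (hn : A.Returns u n) :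
    loop A.f A.x₀ A.η A.g A.F A.T u (n + 1)
      = Status.returned (perturb A.f A.g A.T n (u n) (A.mem u n)).xTilde := by
  rw [loop, loop_of_alive h]
  exact if_pos hn

lemma hitCount_succ_le (S : Set (Vec d)) (n : ℕ) :
    A.hitCount u S (n + 1) ≤ A.hitCount u S n + 1 := by
  classical
  rw [hitCount, Finset.range_add_one, Finset.filter_insert]
  split_ifs
  · exact Finset.card_insert_le _ _
  · exact Nat.le_succ _

lemma hitCount_succ_of_not_hits {S : Set (Vec d)} {n : ℕ} (h : ¬ A.Hits u S n) :
    A.hitCount u S (n + 1) = A.hitCount u S n := by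
  classical
  rw [hitCount, Finset.range_add_one, Finset.filter_insert, if_neg h]
  rfl

/-- The state before iteration `n`: either all progress so far is accounted for, or fewer than
`T + 1` iterations have passed since a perturbation. -/
def Invariant (A : Config d) (u : ℕ → Vec d) (S : Set (Vec d)) (a : ℝ) (n : ℕ) : Prop :=
  ((n : ℤ) - (A.mem u n).tNoise > A.T ∧ a * n ≤ A.f A.x₀ - A.f (A.mem u n).x ∧
    A.F * A.hitCount u S n ≤ A.f A.x₀ - A.f (A.mem u n).x) ∨
  ∃ k j : ℕ, n = k + j ∧ 1 ≤ j ∧ j ≤ A.T ∧ A.Perturbs u k ∧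
    A.mem u n = ⟨(gdStep A.f A.η)^[j] ((A.mem u k).x + u k), (A.mem u k).x, k⟩ ∧
    a * k ≤ A.f A.x₀ - A.f (A.mem u k).x ∧
    A.F * A.hitCount u S n ≤ A.f A.x₀ - A.f (A.mem u k).x + A.F

variable {S : Set (Vec d)} {ℓ a m : ℝ}

/-- A step with large gradient pays `a` by itself. A round of `T + 1` iterations after a
perturbation is paid by its decrease `F` once it passes the return test; until then one hit is
outstanding, whence the extra `F`. -/
lemma invariant (hf : IsSmooth ℓ A.f) (hη : 0 ≤ A.η) (hηℓ : A.η * ℓ ≤ 1) (hT : 1 ≤ A.T)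
    (hF : 0 < A.F) (hg : 0 ≤ A.g) (ha : a ≤ A.η / 2 * A.g ^ 2) (haF : a * (A.T + 1) ≤ A.F)
    {n : ℕ} (h : A.Alive u n) : A.Invariant u S a n := by
  induction n with
  | zero =>
    left
    refine ⟨?_, by simp [mem, initMemory], by simp [mem, initMemory, hitCount]⟩
    simp only [mem, initMemory]; push_cast; omega
  | succ n ih =>
    have halive : A.Alive u n := fun k hk => h k (by omega)
    have hret : ¬ A.Returns u n := h n (by omega)
    rcases ih halive with ⟨h1, h2, h3⟩ | ⟨k, j, rfl, hj1, hjT, hk, hmem, h2, h3⟩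
    · by_cases hp : A.Perturbs u n
      · right
        refine ⟨n, 1, rfl, le_rfl, hT, hp, ?_, h2, ?_⟩
        · rw [mem, perturb_of_perturbs hp]; rfl
        · have : (A.hitCount u S (n + 1) : ℝ) ≤ A.hitCount u S n + 1 := by
            exact_mod_cast hitCount_succ_le S n
          nlinarith
      · left
        have hx : (A.mem u (n + 1)).x = gdStep A.f A.η (A.mem u n).x := by
          rw [mem, perturb_of_not_perturbs hp]
        have ht : (A.mem u (n + 1)).tNoise = (A.mem u n).tNoise := by
          rw [mem, perturb_of_not_perturbs hp]
        have hgr : A.g < ‖gradient A.f (A.mem u n).x‖ := by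
          by_contra! hc
          exact hp ⟨hc, h1⟩
        have hstep := hf.gdStep_le hη hηℓ (A.mem u n).x
        have h4 : A.η / 2 * A.g ^ 2 ≤ A.η / 2 * ‖gradient A.f (A.mem u n).x‖ ^ 2 := by gcongr
        have h5 := hf.gdStep_le_self hη hηℓ (A.mem u n).x
        rw [hitCount_succ_of_not_hits fun hh => hp hh.2.1, hx, ht]
        refine ⟨by push_cast; omega, by push_cast; linarith, by linarith⟩
    · have hp : ¬ A.Perturbs u (k + j) := fun hp => by
        have := hp.2
        rw [hmem] at this
        push_cast at this
        omega
      have hmem' : A.mem u (k + j + 1)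
          = ⟨(gdStep A.f A.η)^[j + 1] ((A.mem u k).x + u k), (A.mem u k).x, k⟩ := by
        rw [mem, perturb_of_not_perturbs hp, hmem, Function.iterate_succ_apply']
      have hcount : A.hitCount u S (k + j + 1) = A.hitCount u S (k + j) :=
        hitCount_succ_of_not_hits fun hh => hp hh.2.1
      rcases hjT.lt_or_eq with hj | rfl
      · right
        exact ⟨k, j + 1, by ring, by omega, hj, hk, hmem', h2, by rwa [hcount]⟩
      -- Iteration `k + T` did not return, so the round has gained `F`. It still takes a gradient
      -- step, which makes `T + 1` iterations in all.
      · left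
        have hdec : A.f ((gdStep A.f A.η)^[A.T] ((A.mem u k).x + u k))
            ≤ A.f (A.mem u k).x - A.F := by
          by_contra! hc
          refine hret ?_
          rw [Returns, perturb_of_not_perturbs hp, hmem]
          refine ⟨by push_cast; ring, by simp only; linarith⟩
        have hstep := hf.gdStep_le_self hη hηℓ ((gdStep A.f A.η)^[A.T] ((A.mem u k).x + u k))
        rw [hmem', hcount, Function.iterate_succ_apply']
        refine ⟨by push_cast; omega, ?_, by simp only; linarith⟩
        push_cast
        linarith

/-- The loop returns, whatever the perturbations are, and it does so because the last perturbation
did not lead to a decrease. -/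
lemma exists_loop_eq_returned (hf : IsSmooth ℓ A.f) (hη : 0 ≤ A.η) (hηℓ : A.η * ℓ ≤ 1)
    (hT : 1 ≤ A.T) (hF : 0 < A.F) (hg : 0 ≤ A.g) (ha0 : 0 < a) (ha : a ≤ A.η / 2 * A.g ^ 2)
    (haF : a * (A.T + 1) ≤ A.F) (hm : ∀ x, m ≤ A.f x) :
    ∃ k : ℕ, A.Alive u k ∧ A.Perturbs u k ∧ a * k ≤ A.f A.x₀ - m ∧
      loop A.f A.x₀ A.η A.g A.F A.T u (k + A.T + 1) = Status.returned (A.mem u k).x ∧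
      A.f (A.mem u k).x - A.F < A.f ((gdStep A.f A.η)^[A.T] ((A.mem u k).x + u k)) := by
  classical
  have hex : ∃ n, A.Returns u n := by
    by_contra! hc
    obtain ⟨n, hn⟩ := exists_nat_gt ((A.f A.x₀ - m) / a + A.T)
    have hn' : A.f A.x₀ - m < a * (n - A.T) := by
      rw [← div_lt_iff₀' ha0]; linarith
    rcases invariant (S := ∅) hf hη hηℓ hT hF hg ha haF (fun k _ => hc k : A.Alive u n) with
      ⟨-, h2, -⟩ | ⟨k, j, rfl, -, hj, -, -, h2, -⟩
    · have := hm (A.mem u n).x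
      have : 0 ≤ a * A.T := by positivity
      linarith
    · have := hm (A.mem u k).x
      have hj' : (j : ℝ) ≤ A.T := by exact_mod_cast hj
      push_cast at hn'
      nlinarith
  have halive : A.Alive u (Nat.find hex) := fun k hk => Nat.find_min hex hk
  have hret := Nat.find_spec hex
  set n := Nat.find hex
  rcases invariant (S := ∅) hf hη hηℓ hT hF hg ha haF halive with
    ⟨h1, -, -⟩ | ⟨k, j, hn, hj1, hj, hk, hmem, h2, -⟩
  -- A return needs `n - t_noise = T`, but here the difference is `0` after a perturbation and
  -- larger than `T` otherwise.
  · exfalso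
    have h0 := hret.1
    by_cases hp : A.Perturbs u n
    · rw [perturb_of_perturbs hp] at h0
      simp only at h0
      omega
    · rw [perturb_of_not_perturbs hp] at h0
      omega
  · have hp : ¬ A.Perturbs u n := fun hp => by
      have := hp.2
      rw [hmem] at this
      push_cast at this
      omega
    have hloop := loop_of_returns halive hret
    obtain ⟨h3, h4⟩ := hret
    rw [perturb_of_not_perturbs hp, hmem] at hloop h3 h4
    simp only at hloop h3 h4
    have hjT : j = A.T := by omega
    subst hjT
    refine ⟨k, fun i hi => halive i (by omega), hk, by linarith [hm (A.mem u k).x], ?_,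
      by linarith⟩
    rw [← hn, hloop]

/-- If all points of `S` have values that exceed the infimum by `F`, then the number of
perturbations of points of `S` is controlled by the initial gap. -/
lemma mul_hitCount_le (hf : IsSmooth ℓ A.f) (hη : 0 ≤ A.η) (hηℓ : A.η * ℓ ≤ 1)
    (hT : 1 ≤ A.T) (hF : 0 < A.F) (hg : 0 ≤ A.g) (hm : ∀ x, m ≤ A.f x)
    (hS : ∀ x ∈ S, A.F ≤ A.f x - m) (n : ℕ) :
    A.F * A.hitCount u S n ≤ A.f A.x₀ - m := by
  induction n with
  | zero => simpa [hitCount] using hm A.x₀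
  | succ n ih =>
    by_cases hh : A.Hits u S n
    · have hle : (A.hitCount u S (n + 1) : ℝ) ≤ A.hitCount u S n + 1 := by
        exact_mod_cast hitCount_succ_le S n
      -- At a hit no round is pending, so all earlier hits are paid for, and the new one is covered
      -- by the height of the point above `m`.
      have hgap := hS _ hh.2.2
      rcases invariant (S := S) (a := 0) hf hη hηℓ hT hF hg (by positivity)
        (by rw [zero_mul]; exact hF.le) hh.1 with ⟨-, -, h3⟩ | ⟨k, j, rfl, -, hj, -, hmem, -⟩
      · nlinarith
      · have := hh.2.1.2
        rw [hmem] at this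
        push_cast at this
        omega
    · rwa [hitCount_succ_of_not_hits hh]

/-! ### Dependence on the perturbations -/

lemma mem_congr {u v : ℕ → Vec d} {n : ℕ} (h : ∀ i < n, u i = v i) :
    A.mem u n = A.mem v n := by
  induction n with
  | zero => rfl
  | succ n ih => rw [mem, mem, ih fun i hi => h i (by omega), h n (by omega)]

/-- Whether iteration `n` perturbs a point of `S` is decided before `u n` is used; this makes `u n`
fresh randomness. -/
lemma hits_congr {u v : ℕ → Vec d} {n : ℕ} (h : ∀ i < n, u i = v i) :
    A.Hits u S n ↔ A.Hits v S n := by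
  have hret : ∀ k < n, (A.Returns u k ↔ A.Returns v k) := fun k hk => by
    rw [Returns, Returns, mem_congr fun i hi => h i (by omega), h k hk]
  have halive : A.Alive u n ↔ A.Alive v n :=
    forall_congr' fun k => forall_congr' fun hk => not_congr (hret k hk)
  rw [Hits, Hits, halive, Perturbs, Perturbs, mem_congr h]

lemma measurable_perturb {f : Vec d → ℝ} (hf : IsSmooth ℓ f) (g : ℝ) (T n : ℕ)
    {α : Type*} [MeasurableSpace α] {ζ : α → Vec d} {s : α → Memory d} (hζ : Measurable ζ)
    (hs : (Measurable fun v => (s v).x) ∧ (Measurable fun v => (s v).xTilde) ∧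
      Measurable fun v => (s v).tNoise) :
    (Measurable fun v => (perturb f g T n (ζ v) (s v)).x) ∧
    (Measurable fun v => (perturb f g T n (ζ v) (s v)).xTilde) ∧
      Measurable fun v => (perturb f g T n (ζ v) (s v)).tNoise := by
  classical
  obtain ⟨h1, h2, h3⟩ := hs
  have hset : MeasurableSet {v | ‖gradient f (s v).x‖ ≤ g ∧ (n : ℤ) - (s v).tNoise > T} :=
    (measurableSet_le (hf.continuous_gradient.measurable.comp h1).norm measurable_const).inter
      (measurableSet_lt measurable_const (measurable_const.sub h3))
  simp only [perturb, apply_ite Memory.x, apply_ite Memory.xTilde, apply_ite Memory.tNoise]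
  exact ⟨(h1.add hζ).ite hset h1, h1.ite hset h2, measurable_const.ite hset h3⟩

lemma measurable_mem (hf : IsSmooth ℓ A.f) (n : ℕ) :
    (Measurable fun u => (A.mem u n).x) ∧ (Measurable fun u => (A.mem u n).xTilde) ∧
      Measurable fun u => (A.mem u n).tNoise := by
  induction n with
  | zero => exact ⟨measurable_const, measurable_const, measurable_const⟩
  | succ n ih =>
    obtain ⟨h1, h2, h3⟩ := measurable_perturb hf A.g A.T n (measurable_pi_apply n) ih
    exact ⟨(hf.continuous_gdStep A.η).measurable.comp h1, h2, h3⟩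

lemma measurableSet_hits (hf : IsSmooth ℓ A.f) (hS : MeasurableSet S) (n : ℕ) :
    MeasurableSet {u | A.Hits u S n} := by
  have hret : ∀ k, MeasurableSet {u | A.Returns u k} := fun k => by
    obtain ⟨h1, h2, h3⟩ :=
      measurable_perturb hf A.g A.T k (measurable_pi_apply k) (A.measurable_mem hf k)
    exact (measurableSet_eq_fun (measurable_const.sub h3) measurable_const).inter
      (measurableSet_lt measurable_const
        ((hf.1.continuous.measurable.comp h1).sub (hf.1.continuous.measurable.comp h2)))
  have halive : MeasurableSet {u | A.Alive u n} := by
    have : {u | A.Alive u n} = ⋂ k ∈ Set.Iio n, {u | A.Returns u k}ᶜ := by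
      ext; simp [Alive]
    rw [this]
    exact MeasurableSet.biInter (Set.to_countable _) fun k _ => (hret k).compl
  obtain ⟨h1, h2, h3⟩ := A.measurable_mem hf n
  exact halive.inter (((measurableSet_le (hf.continuous_gradient.measurable.comp h1).norm
    measurable_const).inter (measurableSet_lt measurable_const (measurable_const.sub h3))).inter
      (h1 hS))

end Config

end

section

variable {d : ℕ}

/-! ### The failure probability -/

/-- If `Y` is independent of `X` and each section of `B` over `A` has small probability under the
law of `Y`, then `B` happens rarely compared with `A`. -/
lemma measure_inter_le_of_indepFun {Ω α β : Type*} [MeasurableSpace Ω] [MeasurableSpace α]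
    [MeasurableSpace β] {P : Measure Ω} [IsProbabilityMeasure P] {X : Ω → α} {Y : Ω → β}
    (hX : Measurable X) (hY : Measurable Y) (hXY : IndepFun X Y P) {A : Set α}
    (hA : MeasurableSet A) {B : Set (α × β)} (hB : MeasurableSet B) {p : ENNReal}
    (hp : ∀ a ∈ A, P.map Y {b | (a, b) ∈ B} ≤ p) :
    P {ω | X ω ∈ A ∧ (X ω, Y ω) ∈ B} ≤ p * P {ω | X ω ∈ A} := by
  have : IsProbabilityMeasure (P.map Y) := Measure.isProbabilityMeasure_map hY.aemeasurable
  have hAB : MeasurableSet ((Prod.fst ⁻¹' A) ∩ B) := (measurable_fst hA).inter hB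
  have h1 : P {ω | X ω ∈ A ∧ (X ω, Y ω) ∈ B}
      = (P.map X).prod (P.map Y) ((Prod.fst ⁻¹' A) ∩ B) := by
    rw [← hXY.map_prod_eq_prod_map_map hX.aemeasurable hY.aemeasurable,
      Measure.map_apply (hX.prodMk hY) hAB]
    rfl
  rw [h1, Measure.prod_apply hAB]
  calc _ ≤ ∫⁻ a, A.indicator (fun _ => p) a ∂(P.map X) := by
        refine lintegral_mono fun a => ?_
        by_cases ha : a ∈ A
        · rw [Set.indicator_of_mem ha]
          refine le_trans (measure_mono ?_) (hp a ha)
          intro b hb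
          exact hb.2
        · rw [Set.indicator_of_notMem ha]
          refine (measure_mono_null ?_ measure_empty).le
          intro b hb
          exact ha hb.1
    _ = _ := by
        rw [lintegral_indicator_const hA, Measure.map_apply hX hA]
        rfl

namespace Config

variable {A : Config d} {S : Set (Vec d)} {ℓ m : ℝ}

/-- A perturbation of a point of `S` that does not lead to a decrease. -/
def Fails (A : Config d) (u : ℕ → Vec d) (S : Set (Vec d)) (n : ℕ) : Prop :=
  A.Hits u S n ∧
    A.f (A.mem u n).x - A.F < A.f ((gdStep A.f A.η)^[A.T] ((A.mem u n).x + u n))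

variable {Ω : Type*} [MeasurableSpace Ω] {P : Measure Ω} [IsProbabilityMeasure P]
  {ξ : ℕ → Ω → Vec d}

/-- Condition on the first `n` perturbations: they determine the perturbed point and are independent
of `ξ n`. -/
lemma measure_fails_le (hf : IsSmooth ℓ A.f) (hS : MeasurableSet S)
    (hξ : ∀ t, Measurable (ξ t)) (hind : iIndepFun ξ P) {p : ENNReal} (n : ℕ)
    (hp : ∀ z ∈ S, ‖gradient A.f z‖ ≤ A.g →
      P.map (ξ n) {ζ | A.f z - A.F < A.f ((gdStep A.f A.η)^[A.T] (z + ζ))} ≤ p) :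
    P {ω | A.Fails (fun t => ξ t ω) S n} ≤ p * P {ω | A.Hits (fun t => ξ t ω) S n} := by
  let X : Ω → (Finset.range n → Vec d) := fun ω i => ξ i ω
  have hX : Measurable X := measurable_pi_lambda _ fun i => hξ i
  -- Padding with zeros is harmless, as the state before iteration `n` ignores the later
  -- coordinates.
  let E : (Finset.range n → Vec d) → ℕ → Vec d :=
    fun v i => if h : i ∈ Finset.range n then v ⟨i, h⟩ else 0
  have hE : Measurable E := by
    refine measurable_pi_lambda _ fun i => ?_
    by_cases h : i ∈ Finset.range n
    · simp only [E, h, dite_true]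
      exact measurable_pi_apply (X := fun _ : Finset.range n => Vec d) ⟨i, h⟩
    · simp only [E, h, dite_false]
      exact measurable_const
  have hEX : ∀ ω, ∀ i < n, E (X ω) i = ξ i ω := fun ω i hi => by simp [E, X, hi]
  have hXY : IndepFun X (ξ n) P := by
    have h := hind.indepFun_finset (Finset.range n) {n} (by simp) hξ
    exact h.comp (φ := id) (ψ := fun v => v ⟨n, by simp⟩) measurable_id
      (measurable_pi_apply (X := fun _ : ({n} : Finset ℕ) => Vec d) ⟨n, by simp⟩)
  have hmem := (A.measurable_mem hf n).1.comp hE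
  have hfm := hf.1.continuous.measurable
  have hB : MeasurableSet {q : (Finset.range n → Vec d) × Vec d |
      A.f (A.mem (E q.1) n).x - A.F
        < A.f ((gdStep A.f A.η)^[A.T] ((A.mem (E q.1) n).x + q.2))} := by
    have h1 : Measurable fun q : (Finset.range n → Vec d) × Vec d => (A.mem (E q.1) n).x :=
      hmem.comp measurable_fst
    refine measurableSet_lt ((hfm.comp h1).sub_const _) ?_
    exact hfm.comp ((((hf.continuous_gdStep A.η).iterate A.T).measurable).comp
      (h1.add measurable_snd))
  have key := measure_inter_le_of_indepFun hX (hξ n) hXY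
    (hE (A.measurableSet_hits hf hS n)) hB (p := p) (fun v hv => hp _ hv.2.2 hv.2.1.1)
  have hits_iff : ∀ ω, X ω ∈ E ⁻¹' {u | A.Hits u S n} ↔ A.Hits (fun t => ξ t ω) S n :=
    fun ω => hits_congr (hEX ω)
  simp only [hits_iff] at key
  convert key using 4 with ω
  simp only [Fails, Set.mem_ofPred_eq]
  rw [mem_congr (hEX ω)]

/-- The probability that some perturbation of a point of `S` does not lead to a decrease. -/
lemma measure_exists_fails_le (hf : IsSmooth ℓ A.f) (hη : 0 ≤ A.η) (hηℓ : A.η * ℓ ≤ 1)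
    (hT : 1 ≤ A.T) (hF : 0 < A.F) (hg : 0 ≤ A.g) (hm : ∀ x, m ≤ A.f x)
    (hSm : MeasurableSet S) (hS : ∀ x ∈ S, A.F ≤ A.f x - m)
    (hξ : ∀ t, Measurable (ξ t)) (hind : iIndepFun ξ P) {p : ENNReal}
    (hp : ∀ n, ∀ z ∈ S, ‖gradient A.f z‖ ≤ A.g →
      P.map (ξ n) {ζ | A.f z - A.F < A.f ((gdStep A.f A.η)^[A.T] (z + ζ))} ≤ p) :
    P {ω | ∃ n, A.Fails (fun t => ξ t ω) S n} ≤ p * ENNReal.ofReal ((A.f A.x₀ - m) / A.F) := by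
  classical
  have hmeas : ∀ n, MeasurableSet {ω | A.Hits (fun t => ξ t ω) S n} := fun n =>
    (measurable_pi_lambda (fun ω t => ξ t ω) hξ) (A.measurableSet_hits hf hSm n)
  -- The sum of the hit probabilities is the expected hit count, which is bounded pointwise.
  have hcount : ∀ n, ∑ k ∈ Finset.range n, P {ω | A.Hits (fun t => ξ t ω) S k}
      ≤ ENNReal.ofReal ((A.f A.x₀ - m) / A.F) := by
    intro n
    calc _ = ∑ k ∈ Finset.range n,
          ∫⁻ ω, {ω | A.Hits (fun t => ξ t ω) S k}.indicator 1 ω ∂P := by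
          simp only [lintegral_indicator_one (hmeas _)]
      _ = ∫⁻ ω, ∑ k ∈ Finset.range n, {ω | A.Hits (fun t => ξ t ω) S k}.indicator 1 ω ∂P :=
          (lintegral_finsetSum _ fun k _ => measurable_one.indicator (hmeas k)).symm
      _ ≤ ∫⁻ _, ENNReal.ofReal ((A.f A.x₀ - m) / A.F) ∂P := by
          refine lintegral_mono fun ω => ?_
          have h1 : ∑ k ∈ Finset.range n,
              ({ω | A.Hits (fun t => ξ t ω) S k}.indicator 1 ω : ENNReal)
              = (A.hitCount (fun t => ξ t ω) S n : ENNReal) := by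
            simp only [Set.indicator_apply, Set.mem_ofPred_eq, Pi.one_apply, Finset.sum_boole,
              hitCount]
          rw [h1, ← ENNReal.ofReal_natCast]
          refine ENNReal.ofReal_le_ofReal ?_
          rw [le_div_iff₀' hF]
          exact mul_hitCount_le hf hη hηℓ hT hF hg hm hS n
      _ = _ := by simp
  calc P {ω | ∃ n, A.Fails (fun t => ξ t ω) S n}
      = P (⋃ n, {ω | A.Fails (fun t => ξ t ω) S n}) := by rw [Set.ofPred_exists]
    _ ≤ ∑' n, P {ω | A.Fails (fun t => ξ t ω) S n} := measure_iUnion_le _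
    _ ≤ ∑' n, p * P {ω | A.Hits (fun t => ξ t ω) S n} :=
        ENNReal.tsum_le_tsum fun n => measure_fails_le hf hSm hξ hind n (hp n)
    _ = p * ∑' n, P {ω | A.Hits (fun t => ξ t ω) S n} := ENNReal.tsum_mul_left
    _ ≤ _ := by
        gcongr
        exact ENNReal.tsum_le_of_sum_range_le hcount

end Config

end

section

variable {d : ℕ} {f : Vec d → ℝ} {ℓ ρ : ℝ}

/-! ### Numerical estimates -/

/-- Among the five factors `exp (χ / 3)` of `exp (5 χ / 3)`, four dominate `χ ^ 4` and the fifth, at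
least `28`, absorbs the constant. -/
lemma mul_pow_four_mul_exp_le {χ : ℝ} (hχ : 12 ≤ χ) :
    84 * χ ^ 4 * Real.exp (-2 * χ) * Real.exp (χ / 3) ≤ 1 := by
  have h1 : 1.35 * (χ / 3) ≤ Real.exp (χ / 6) := by
    have h := Real.add_one_le_exp (χ / 6 - 1)
    have he := Real.exp_one_gt_d9
    calc 1.35 * (χ / 3) ≤ Real.exp 1 * (χ / 6) := by nlinarith
      _ ≤ Real.exp 1 * Real.exp (χ / 6 - 1) := by gcongr; linarith
      _ = _ := by rw [← Real.exp_add]; ring_nf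
  have h2 : 7 * (χ / 3) ≤ Real.exp (χ / 3) := by
    calc 7 * (χ / 3) ≤ (1.35 * (χ / 3)) ^ 2 := by nlinarith
      _ ≤ Real.exp (χ / 6) ^ 2 := by gcongr
      _ = _ := by rw [← Real.exp_nat_mul]; congr 1; push_cast; ring
  have h3 : 84 * χ ^ 4 ≤ Real.exp (5 * (χ / 3)) := by
    calc 84 * χ ^ 4 ≤ 28 * (7 * (χ / 3)) ^ 4 := by nlinarith [pow_nonneg (show 0 ≤ χ by linarith) 4]
      _ ≤ Real.exp (χ / 3) * Real.exp (χ / 3) ^ 4 := by gcongr; linarith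
      _ = _ := by rw [← Real.exp_nat_mul, ← Real.exp_add]; congr 1; push_cast; ring
  rw [mul_assoc, ← Real.exp_add]
  calc _ ≤ Real.exp (5 * (χ / 3)) * Real.exp (-2 * χ + χ / 3) := by gcongr
    _ = 1 := by rw [← Real.exp_add, ← Real.exp_zero]; congr 1; ring

lemma twelve_le_chi (d : ℕ) (ℓ ε c δ Δf : ℝ) : 12 ≤ chi d ℓ ε c δ Δf := by
  have := le_max_right (Real.log (d * ℓ * Δf / (c * ε ^ 2 * δ))) 4
  rw [chi]; linarith

lemma le_exp_chi (d : ℕ) (ℓ ε c δ Δf : ℝ) :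
    d * ℓ * Δf / (c * ε ^ 2 * δ) ≤ Real.exp (chi d ℓ ε c δ Δf / 3) := by
  have h := le_max_left (Real.log (d * ℓ * Δf / (c * ε ^ 2 * δ))) 4
  rw [chi, mul_div_cancel_left₀ _ three_ne_zero]
  exact (Real.le_exp_log _).trans (Real.exp_le_exp.2 h)

/-- Removing `c` from the logarithm costs the summand `-log c ≥ 0`, which becomes a factor because
the truncated logarithm is at least `1`. -/
lemma chi_le {ε c δ Δf : ℝ} (hc : 0 < c) (hc1 : c ≤ 1) :
    chi d ℓ ε c δ Δf ≤
      (12 - 3 * Real.log c) * max 1 (Real.log (d * ℓ * Δf / (ε ^ 2 * δ))) := by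
  set Y := d * ℓ * Δf / (ε ^ 2 * δ) with hY
  have hXY : d * ℓ * Δf / (c * ε ^ 2 * δ) = Y / c := by
    rw [hY, div_div]; congr 1; ring
  have hlc : Real.log c ≤ 0 := Real.log_nonpos hc.le hc1
  have h1 := le_max_left 1 (Real.log Y)
  have h2 := le_max_right 1 (Real.log Y)
  set L := max 1 (Real.log Y)
  have hlog : Real.log (Y / c) ≤ L - Real.log c := by
    by_cases hY0 : Y = 0
    · rw [hY0, zero_div, Real.log_zero]; linarith
    · rw [Real.log_div hY0 hc.ne']; linarith
  have hmul : -Real.log c ≤ -Real.log c * L := le_mul_of_one_le_right (by linarith) h1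
  have hmax : max (Real.log (d * ℓ * Δf / (c * ε ^ 2 * δ))) 4 ≤ (4 - Real.log c) * L := by
    rw [hXY]
    exact max_le (by linarith) (by linarith)
  rw [chi]; linarith

/-! ### The guarantee -/

/-- Perturbed gradient descent returns a second-order stationary point with high probability.
The accuracy is `ε = ρ s²` and the constant is `c = b²`. -/
lemma loop_spec (hd : 0 < d) {χ b s δ m : ℝ} {T : ℕ} (hχ : 12 ≤ χ) (hb : 0 < b)
    (hb' : b ≤ 1 / 256) (hs : 0 < s) (hρ : 0 < ρ) (hℓ : 0 < ℓ) (hsℓ : ρ * s ≤ ℓ)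
    (hf : IsSmooth ℓ f) (hH : IsHessianLipschitz ρ f) (x₀ : Vec d) (hm : ∀ x, m ≤ f x)
    (hT : χ / b ^ 4 * (ℓ / (ρ * s)) ≤ T) (hT' : (T + 1 : ℝ) ≤ 3 * (χ / b ^ 4 * (ℓ / (ρ * s))))
    (hδ : d * ℓ * (f x₀ - m) / (b ^ 2 * (ρ * s ^ 2) ^ 2) ≤ δ * Real.exp (χ / 3))
    {Ω : Type*} [MeasurableSpace Ω] {P : Measure Ω} [IsProbabilityMeasure P]
    {ξ : ℕ → Ω → Vec d} (hξ : ∀ t, Measurable (ξ t)) (hind : iIndepFun ξ P)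
    (hunif : ∀ t, pdf.IsUniform (ξ t) (Metric.closedBall 0 (b / χ ^ 2 * (ρ * s ^ 2 / ℓ)))
      P volume) :
    ENNReal.ofReal (1 - δ) ≤ P {ω | ∃ (k : ℕ) (y : Vec d),
      loop f x₀ (b ^ 2 / ℓ) (b / χ ^ 2 * (ρ * s ^ 2)) (b ^ 2 / χ ^ 3 * (ρ * s ^ 3)) T
        (fun t => ξ t ω) (k + T + 1) = Status.returned y ∧
      IsSecondOrderStationary ρ (ρ * s ^ 2) f y ∧
      b ^ 6 * (ρ * s ^ 2) ^ 2 / (3 * χ ^ 4 * ℓ) * k ≤ f x₀ - m} := by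
  have hχ0 : 0 < χ := by linarith
  set F := b ^ 2 / χ ^ 3 * (ρ * s ^ 3) with hF
  set g := b / χ ^ 2 * (ρ * s ^ 2) with hg
  -- The guaranteed progress per iteration: `F` divided by the upper bound for `T + 1`.
  set a := b ^ 6 * (ρ * s ^ 2) ^ 2 / (3 * χ ^ 4 * ℓ) with ha
  have hF0 : 0 < F := by positivity
  have hg0 : 0 < g := by positivity
  have hη0 : 0 ≤ b ^ 2 / ℓ := by positivity
  have hb2 : b ^ 2 ≤ 1 := by nlinarith
  have hηℓ : b ^ 2 / ℓ * ℓ ≤ 1 := by rwa [div_mul_cancel₀ _ hℓ.ne']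
  have hT1 : 1 ≤ T := by
    have : (0 : ℝ) < T := lt_of_lt_of_le (by positivity) hT
    exact_mod_cast this
  have hag : a ≤ b ^ 2 / ℓ / 2 * g ^ 2 := by
    have : a = b ^ 2 / ℓ / 2 * g ^ 2 * (2 / 3 * b ^ 2) := by rw [ha, hg]; field_simp
    rw [this]
    exact mul_le_of_le_one_right (by positivity) (by linarith)
  have haF : a * (T + 1) ≤ F := by
    calc a * (T + 1) ≤ a * (3 * (χ / b ^ 4 * (ℓ / (ρ * s)))) := by gcongr
      _ = F := by rw [ha, hF]; field_simp
  let A : Config d := ⟨f, x₀, b ^ 2 / ℓ, g, F, T⟩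
  -- Moving a distance `s` along the eigenvector gains `γ s² / 2 - ρ s³ / 3 = ρ s³ / 6`.
  have hgap : ∀ x ∈ saddleSet (ρ * s) f, F ≤ f x - m := by
    intro x hx
    refine le_trans ?_ (hH.le_of_mem_saddleSet hρ.le hm hs.le hx)
    have h1 : b ^ 2 / χ ^ 3 ≤ 1 / 6 := by
      rw [div_le_iff₀ (by positivity)]
      have : (12 : ℝ) ^ 3 ≤ χ ^ 3 := by gcongr
      linarith
    calc F ≤ 1 / 6 * (ρ * s ^ 3) := by rw [hF]; gcongr
      _ = _ := by ring
  have hfail := A.measure_exists_fails_le (P := P) (ξ := ξ) (m := m) (S := saddleSet (ρ * s) f)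
    (p := ENNReal.ofReal (84 * χ * Real.exp (-2 * χ) * (d * (ℓ / (ρ * s))))) hf hη0 hηℓ hT1 hF0
    hg0.le hm (hH.isOpen_saddleSet _).measurableSet hgap hξ hind
    (fun n z hz hgz => by
      have hn := hunif n
      rw [pdf.IsUniform] at hn
      rw [hn]
      exact cond_stuck_le hd hχ hb hb' hs hρ hℓ hsℓ hf hH hT hgz hz)
  have hδ0 : 0 ≤ δ := by
    have h0 : 0 ≤ d * ℓ * (f x₀ - m) / (b ^ 2 * (ρ * s ^ 2) ^ 2) := by
      have := sub_nonneg.2 (hm x₀)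
      positivity
    exact nonneg_of_mul_nonneg_left (h0.trans hδ) (Real.exp_pos _)
  have hfail' : P {ω | ∃ n, A.Fails (fun t => ξ t ω) (saddleSet (ρ * s) f) n}
      ≤ ENNReal.ofReal δ := by
    refine hfail.trans ?_
    rw [← ENNReal.ofReal_mul (by positivity)]
    refine ENNReal.ofReal_le_ofReal ?_
    calc _ = 84 * χ ^ 4 * Real.exp (-2 * χ)
          * (d * ℓ * (f x₀ - m) / (b ^ 2 * (ρ * s ^ 2) ^ 2)) := by
          simp only [A]; rw [hF]; field_simp
      _ ≤ 84 * χ ^ 4 * Real.exp (-2 * χ) * (δ * Real.exp (χ / 3)) := by gcongr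
      _ = 84 * χ ^ 4 * Real.exp (-2 * χ) * Real.exp (χ / 3) * δ := by ring
      _ ≤ 1 * δ := by gcongr; exact mul_pow_four_mul_exp_le hχ
      _ = δ := one_mul δ
  rw [ENNReal.ofReal_sub _ hδ0, ENNReal.ofReal_one, tsub_le_iff_right]
  -- The good event and the failure event cover `Ω`; subadditivity needs no measurability of either.
  refine le_trans ?_ (add_le_add le_rfl hfail')
  refine le_trans ?_ (measure_union_le _ _)
  rw [← measure_univ (μ := P)]
  refine measure_mono fun ω _ => ?_
  obtain ⟨k, hk1, hk2, hk3, hk4, hk5⟩ := A.exists_loop_eq_returned (u := fun t => ξ t ω) (m := m)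
    (a := a) hf hη0 hηℓ hT1 hF0 hg0.le (by positivity) hag haF hm
  by_cases hsad : (A.mem (fun t => ξ t ω) k).x ∈ saddleSet (ρ * s) f
  · exact Or.inr ⟨k, ⟨hk1, hk2, hsad⟩, hk5⟩
  · refine Or.inl ⟨k, _, hk4, hH.isSecondOrderStationary hd (hk2.1.trans ?_) ?_, hk3⟩
    · refine mul_le_of_le_one_left (by positivity) ?_
      rw [div_le_one (by positivity)]
      nlinarith
    · rwa [show ρ * (ρ * s ^ 2) = (ρ * s) ^ 2 by ring, Real.sqrt_sq (by positivity)]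

end

end PGD

end

/-! ### Choice of the constants and substitution of the parameters -/

theorem theorem3 :
    ∃ cmax : ℝ, 0 < cmax ∧ ∀ c : ℝ, 0 < c → c ≤ cmax →
      ∃ C : ℝ, 0 < C ∧
        ∀ (d : ℕ) (_ : 0 < d) (f : PGD.Vec d → ℝ) (x₀ : PGD.Vec d)
          (ℓ ρ ε δ Δf fstar : ℝ)
          (_ : 0 < ℓ) (_ : 0 < ρ) (_ : 0 < ε) (_ : 0 < δ)
          (_ : PGD.IsSmooth ℓ f) (_ : PGD.IsHessianLipschitz ρ f)
          (_ : IsGLB (Set.range f) fstar)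
          (_ : ε ≤ ℓ ^ 2 / ρ) (_ : f x₀ - fstar ≤ Δf)
          (Ω : Type*) (_ : MeasurableSpace Ω) (P : Measure Ω) (_ : IsProbabilityMeasure P)
          (ξ : ℕ → Ω → PGD.Vec d)
          (_ : ∀ t, Measurable (ξ t))
          (_ : iIndepFun ξ P)
          (_ : ∀ t, pdf.IsUniform (ξ t) (Metric.closedBall 0 (PGD.radius d ℓ ε c δ Δf)) P volume),
          ENNReal.ofReal (1 - δ) ≤
            P {ω | ∃ (N : ℕ) (y : PGD.Vec d),
              PGD.run f x₀ ℓ ρ ε c δ Δf (fun t => ξ t ω) N = PGD.Status.returned y ∧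
              PGD.IsSecondOrderStationary ρ ε f y ∧
              (N : ℝ) ≤ C * PGD.iterationRate d ℓ ε δ Δf (f x₀ - fstar)
                + (PGD.tThres d ℓ ρ ε c δ Δf + 1) ∧
              (PGD.fThres d ℓ ρ ε c δ Δf ≤ f x₀ - fstar →
                (N : ℝ) ≤ C * PGD.iterationRate d ℓ ε δ Δf (f x₀ - fstar))} := by
  refine ⟨1 / 65536, by norm_num, fun c hc hcmax => ?_⟩
  obtain ⟨b, hb, rfl⟩ : ∃ b : ℝ, 0 < b ∧ c = b ^ 2 :=
    ⟨√c, Real.sqrt_pos.2 hc, (Real.sq_sqrt hc.le).symm⟩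
  have hb' : b ≤ 1 / 256 := by nlinarith
  have hlog : Real.log (b ^ 2) ≤ 0 := Real.log_nonpos hc.le (by linarith)
  have hK : 0 < 12 - 3 * Real.log (b ^ 2) := by linarith
  -- The factor `3 χ ^ 4 / b ^ 6` comes from `1 / a`, with `χ` bounded by `chi_le`. The remaining
  -- `2` accommodates the last round.
  refine ⟨6 * (12 - 3 * Real.log (b ^ 2)) ^ 4 / b ^ 6, by positivity, ?_⟩
  intro d hd f x₀ ℓ ρ ε δ Δf fstar hℓ hρ hε hδ hf hH hglb hεℓ hΔ Ω _ P _ ξ hξ hind hunif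
  obtain ⟨s, hs, rfl⟩ : ∃ s : ℝ, 0 < s ∧ ε = ρ * s ^ 2 :=
    ⟨√(ε / ρ), Real.sqrt_pos.2 (by positivity), by
      rw [Real.sq_sqrt (by positivity)]; field_simp⟩
  have hm : ∀ x, fstar ≤ f x := fun x => hglb.1 ⟨x, rfl⟩
  have hgap : 0 ≤ f x₀ - fstar := sub_nonneg.2 (hm x₀)
  have hsℓ : ρ * s ≤ ℓ := by
    rw [le_div_iff₀ hρ] at hεℓ
    exact le_of_sq_le_sq (by linarith) hℓ.le
  have hsqrt1 : √(ρ * (ρ * s ^ 2)) = ρ * s := by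
    rw [show ρ * (ρ * s ^ 2) = (ρ * s) ^ 2 by ring, Real.sqrt_sq (by positivity)]
  have hsqrt2 : √((ρ * s ^ 2) ^ 3 / ρ) = ρ * s ^ 3 := by
    rw [show (ρ * s ^ 2) ^ 3 / ρ = (ρ * s ^ 3) ^ 2 by field_simp, Real.sqrt_sq (by positivity)]
  have hχ := PGD.twelve_le_chi d ℓ (ρ * s ^ 2) (b ^ 2) δ Δf
  have hχexp := PGD.le_exp_chi d ℓ (ρ * s ^ 2) (b ^ 2) δ Δf
  have hχK := PGD.chi_le (d := d) (ℓ := ℓ) (ε := ρ * s ^ 2) (δ := δ) (Δf := Δf) hc (by linarith)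
  simp only [PGD.radius, Real.sqrt_sq hb.le] at hunif
  simp only [PGD.run, PGD.stepSize, PGD.gThres, PGD.fThres, PGD.tThres, PGD.iterationRate, hsqrt1,
    hsqrt2, Real.sqrt_sq hb.le]
  set χ := PGD.chi d ℓ (ρ * s ^ 2) (b ^ 2) δ Δf
  set L := max 1 (Real.log (d * ℓ * Δf / ((ρ * s ^ 2) ^ 2 * δ)))
  have hχ0 : 0 < χ := by linarith
  have hT : χ / b ^ 4 * (ℓ / (ρ * s)) ≤ (⌈χ / (b ^ 2) ^ 2 * (ℓ / (ρ * s))⌉₊ : ℝ) := by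
    rw [← pow_mul]; exact Nat.le_ceil _
  have hT' : (⌈χ / (b ^ 2) ^ 2 * (ℓ / (ρ * s))⌉₊ + 1 : ℝ)
      ≤ 3 * (χ / b ^ 4 * (ℓ / (ρ * s))) := by
    have h1 : 1 ≤ χ / b ^ 4 * (ℓ / (ρ * s)) := by
      have h2 : 1 ≤ ℓ / (ρ * s) := (one_le_div (by positivity)).2 hsℓ
      have h3 : 1 ≤ χ / b ^ 4 := by
        rw [one_le_div (by positivity)]
        have : b ^ 4 ≤ 1 := pow_le_one₀ hb.le (by linarith)
        linarith
      exact one_le_mul_of_one_le_of_one_le h3 h2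
    have h4 := (Nat.ceil_lt_add_one (a := χ / (b ^ 2) ^ 2 * (ℓ / (ρ * s))) (by positivity)).le
    rw [← pow_mul] at h4 ⊢
    norm_num at h4 ⊢
    linarith
  set T := ⌈χ / (b ^ 2) ^ 2 * (ℓ / (ρ * s))⌉₊
  have hδX : d * ℓ * (f x₀ - fstar) / (b ^ 2 * (ρ * s ^ 2) ^ 2) ≤ δ * Real.exp (χ / 3) := by
    calc _ ≤ d * ℓ * Δf / (b ^ 2 * (ρ * s ^ 2) ^ 2) := by gcongr
      _ = δ * (d * ℓ * Δf / (b ^ 2 * (ρ * s ^ 2) ^ 2 * δ)) := by field_simp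
      _ ≤ _ := by gcongr
  refine (PGD.loop_spec hd hχ hb hb' hs hρ hℓ hsℓ hf hH x₀ hm hT hT' hδX hξ hind hunif).trans
    (measure_mono ?_)
  rintro ω ⟨k, y, hrun, hy, hk⟩
  set a := b ^ 6 * (ρ * s ^ 2) ^ 2 / (3 * χ ^ 4 * ℓ) with ha
  have ha0 : 0 < a := by positivity
  have hrate : 2 * ((f x₀ - fstar) / a) ≤ 6 * (12 - 3 * Real.log (b ^ 2)) ^ 4 / b ^ 6
      * (ℓ * (f x₀ - fstar) / (ρ * s ^ 2) ^ 2 * L ^ 4) := by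
    calc 2 * ((f x₀ - fstar) / a)
        = χ ^ 4 * (6 * (ℓ * (f x₀ - fstar)) / (b ^ 6 * (ρ * s ^ 2) ^ 2)) := by
          rw [ha]; field_simp; ring
      _ ≤ ((12 - 3 * Real.log (b ^ 2)) * L) ^ 4
          * (6 * (ℓ * (f x₀ - fstar)) / (b ^ 6 * (ρ * s ^ 2) ^ 2)) := by gcongr
      _ = _ := by field_simp
  have hk' : (k : ℝ) ≤ (f x₀ - fstar) / a := by rwa [le_div_iff₀' ha0]
  have hpos : 0 ≤ (f x₀ - fstar) / a := by positivity
  refine ⟨k + T + 1, y, hrun, hy, ?_, fun hF => ?_⟩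
  · push_cast; linarith
  -- If the gap is at least `F`, then `a (T + 1) ≤ F` lets the last round be absorbed into the rate.
  · have hTa : (T + 1 : ℝ) ≤ (f x₀ - fstar) / a := by
      rw [le_div_iff₀' ha0]
      refine le_trans ?_ hF
      calc a * (T + 1) ≤ a * (3 * (χ / b ^ 4 * (ℓ / (ρ * s)))) := by gcongr
        _ = _ := by rw [ha]; field_simp
    push_cast; linarith
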